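/- **Setting.** Let $1\le k<n$ be integers. The homogeneous coordinate ring $\mathcal S(\mathrm{Gr}_{V_k}(\mathcal H_{k,n}))$ of the Grassmannian of $k$-dimensional subspaces of an $n$-dimensional complex space is the quotient of the polynomial ring $\mathbb C[\widetilde\pi_L]$, with one indeterminate for every $k$-tuple $L=(L_1,\dots,L_k)$ of integers $-k\le L_i\le n-k-1$ (not necessarily ordered or distinct), by the ideal generated by the skew-symmetry relations $\widetilde\pi_{L_1,\dots,L_k}-\mathrm{sgn}(\sigma)\,\widetilde\pi_{L_{\sigma_1},\dots,L_{\sigma_k}}$ ($\sigma\in S_k$) and the Plücker relations $$\sum_{j=1}^{k+1}(-1)^j\,\widetilde\pi_{I_1,\dots,I_{k-1},J_j}\,\widetilde\pi_{J_1,\dots,\widehat{J_j},\dots,J_{k+1}},$$ for all $(k-1)$-tuples $I$ and $(k+1)$-tuples $J$ of such integers. Write $\mathrm{sgn}(L)$ for the sign of the permutation that puts $L$ into increasing order, and $\mathrm{sgn}(L)=0$ if $L$ has repeated entries. A point $w$ of the infinite Grassmannian $\mathrm{Gr}_{\mathcal H_+}(\mathcal H)$ is given by homogeneous coordinates $(\pi_\lambda)_\lambda\ne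 0$ in $\mathbb C$, up to a nonzero factor, labelled by all partitions $\lambda$ (possibly infinitely many of them nonzero), that satisfy the Plücker relations above for all $k\leq n$, where $\widetilde\pi_L=\mathrm{sgn}(L)\,\pi_\lambda$, $\lambda$ having the parts $\lambda_i=L'_{k-i+1}+i$, $1\le i\le k$, with $L'$ the increasing rearrangement of $L$ (and $\widetilde\pi_L=0$ if $L$ has repeated entries). Its KP $\tau$-function, which depends on the choice of homogeneous coordinates only through a constant factor, is the formal power series $\tau_w(\mathbf t)=\sum_\lambda\pi_\lambda s_\lambda(\mathbf t)\in\mathbb C[[t_1,t_2,\dots]]$, with $s_\lambda$ the Schur function expressed in the normalized power sums $t_i=p_i/i$. Let $\mathbb C[[\mathbf x,\mathbf t]]$ be the ring of formal power series in $x_j$ ($j\in\mathbb Z$) and $t_i$ ($i\ge 1$), and let $(S_{\mathbf x}^\times)^{-1}\mathbb C[[\mathbf x,\mathbf t]]$ be its localization at the multiplicative set generated by all $x_i-x_j$, $i\neq j$. Let $\mathbf A$ be the free abelian group of families $\mathbf n=(n_i)_{i\in\mathbb Z}$ of integers with finitely many nonzero entries, with basis $\boldsymbol\alpha_i$, $i\in\mathbb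 Z$. With $[x]=(x,x^2/2,x^3/3,\dots)$, put $$H_w^{\mathbf n}(\mathbf t)=\prod_{i<j}(x_i-x_j)^{n_in_j}\;\tau_w\Big(\mathbf t+\sum_{i\in\mathbb Z}n_i[x_i]\Big)\in(S_{\mathbf x}^\times)^{-1}\mathbb C[[\mathbf x,\mathbf t]].$$ **Proposition.** Let $w\in\mathrm{Gr}_{\mathcal H_+}(\mathcal H)$ (with any choice of homogeneous coordinates), let $1\le k<n$ be integers and let $\mathbf n\in\mathbf A$. There is a (unique) homomorphism of commutative $\mathbb C$-algebras $$\phi^{\mathbf n}_{w,k,n}:\ \mathcal S(\mathrm{Gr}_{V_k}(\mathcal H_{k,n}))\to(S_{\mathbf x}^\times)^{-1}\mathbb C[[\mathbf x,\mathbf t]]$$ such that $\phi^{\mathbf n}_{w,k,n}(\widetilde\pi_{L_1,\dots,L_k})=\mathrm{sgn}(L)\,H_w^{\mathbf n+\boldsymbol\alpha_{L_1}+\dots+\boldsymbol\alpha_{L_k}}(\mathbf t)$ for every $k$-tuple $L$ of integers in $\{-k,\dots,n-k-1\}$. -/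

import Mathlib

noncomputable section

namespace KPLattice

/-! ### Finite Grassmannians: multi-indices, Plücker relations, coordinate ring -/

/-- The set `{-k, …, n-k-1}` in which the entries of a multi-index lie. -/
abbrev Idx (k n : ℕ) : Type := ↥(Set.Icc (-(k : ℤ)) ((n : ℤ) - (k : ℤ) - 1))

/-- The sign of the permutation that puts `L` into increasing order, and `0` if `L` has
repeated entries. -/
def sgn {k : ℕ} (L : Fin k → ℤ) : ℤ :=
  open Classical in
  if Function.Injective L then (Equiv.Perm.sign (Tuple.sort L) : ℤ) else 0

/-- The polynomial ring `ℂ[π̃_L]` in `n ^ k` indeterminates, one for each `k`-tuple `L` (not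
necessarily ordered or with distinct entries). -/
abbrev PluckerPoly (k n : ℕ) : Type := MvPolynomial (Fin k → Idx k n) ℂ

/-- The skew-symmetry relations `π̃_L - sgn(σ) π̃_{L ∘ σ}`. -/
def skewForms (k n : ℕ) : Set (PluckerPoly k n) :=
  {p | ∃ (L : Fin k → Idx k n) (σ : Equiv.Perm (Fin k)),
    p = MvPolynomial.X L -
      MvPolynomial.C (((Equiv.Perm.sign σ : ℤ) : ℂ)) * MvPolynomial.X (L ∘ σ)}

/-- The Plücker quadratic forms
`∑_{j=1}^{k+1} (-1)^j π̃_{I_1,…,I_{k-1},J_j} π̃_{J_1,…,Ĵ_j,…,J_{k+1}}`, for all `(k-1)`-tuples `I` and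
`(k+1)`-tuples `J`. There are none for `k = 0`. (Lean counts `j` from `0`.) -/
def pluckerForms : (k n : ℕ) → Set (PluckerPoly k n)
  | 0, _ => ∅
  | m + 1, n =>
    {p | ∃ (I : Fin m → Idx (m + 1) n) (J : Fin (m + 2) → Idx (m + 1) n),
      p = ∑ j : Fin (m + 2), (-1) ^ ((j : ℕ) + 1) *
        (MvPolynomial.X (Fin.snoc (α := fun _ => Idx (m + 1) n) I (J j)) *
          MvPolynomial.X (fun a => J (j.succAbove a)))}

/-- The ideal generated by the skew-symmetry and the Plücker relations. -/
def pluckerIdeal (k n : ℕ) : Ideal (PluckerPoly k n) :=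
  Ideal.span (skewForms k n ∪ pluckerForms k n)

/-- The homogeneous coordinate ring of the Grassmannian of `k`-dimensional subspaces of an
`n`-dimensional space. -/
abbrev FinGrRing (k n : ℕ) : Type := PluckerPoly k n ⧸ pluckerIdeal k n

/-- The Plücker coordinate `π̃_L` as an element of the coordinate ring. -/
def pluckerCoord {k n : ℕ} (L : Fin k → Idx k n) : FinGrRing k n :=
  Ideal.Quotient.mk (pluckerIdeal k n) (MvPolynomial.X L)

/-! ### The infinite Grassmannian -/

/-- The partition with parts `λ_i = L_{k-i+1} + i`, `i = 1, …, k`, of a strictly increasing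
`k`-tuple `L` (of integers that are at least `-k`). -/
def partitionOf {k : ℕ} (L : Fin k → ℤ) (hL : StrictMono L) : YoungDiagram :=
  YoungDiagram.ofRowLens
    (List.ofFn fun i : Fin k => (L (Fin.rev i) + ((i : ℕ) : ℤ) + 1).toNat) (by
      rw [List.sortedGE_ofFn_iff]
      have key : ∀ d : ℕ, ∀ a b : Fin k, (a : ℕ) + d = b → L a + d ≤ L b := by
        intro d
        induction d with
        | zero =>
          intro a b h
          have : a = b := Fin.ext (by simpa using h)
          simp [this]
        | succ d ih =>
          intro a b h
          have hc : (b : ℕ) - 1 < k := by have := b.2; omega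
          have h1 := ih a ⟨(b : ℕ) - 1, hc⟩ (by simp; omega)
          have h2 : L ⟨(b : ℕ) - 1, hc⟩ < L b := hL (by rw [Fin.lt_def]; simp; omega)
          push_cast
          omega
      intro i j hij
      have hij' : (i : ℕ) ≤ (j : ℕ) := hij
      have := key ((j : ℕ) - (i : ℕ)) (Fin.rev j) (Fin.rev i) (by
        simp only [Fin.val_rev]; have := j.2; have := i.2; omega)
      apply Int.toNat_le_toNat
      push_cast [hij'] at this
      omega)

/-- The Plücker coordinates labelled by multi-indices of a family labelled by partitions: if `L`
has distinct entries, `π̃_L` is `sgn(L)` times `π_λ`, `λ` being the partition of the increasing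
rearrangement of `L`; otherwise `π̃_L = 0`. -/
def tildeCoord (π : YoungDiagram → ℂ) {k : ℕ} (L : Fin k → ℤ) : ℂ :=
  open Classical in
  if h : Function.Injective L then
    (sgn L : ℂ) * π (partitionOf (L ∘ Tuple.sort L)
      ((Tuple.monotone_sort L).strictMono_of_injective (h.comp (Tuple.sort L).injective)))
  else 0

/-- The family `(π_λ)` satisfies all the Plücker relations, for all `0 ≤ k ≤ n`. -/
def SatisfiesPlucker (π : YoungDiagram → ℂ) : Prop :=
  ∀ k n : ℕ, k ≤ n → ∀ p ∈ pluckerForms k n,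
    MvPolynomial.eval (fun L : Fin k → Idx k n => tildeCoord π (fun i => (L i : ℤ))) p = 0

/-- The (Sato) infinite Grassmannian: points of the projective space with homogeneous coordinates
`π_λ`, labelled by all partitions (with possibly infinitely many nonzero coordinates), that satisfy
the full set of Plücker relations. -/
def InfGrassmannian : Set (Projectivization ℂ (YoungDiagram → ℂ)) :=
  {w | SatisfiesPlucker w.rep}

theorem tildeCoord_smul (c : ℂ) (π : YoungDiagram → ℂ) {k : ℕ} (L : Fin k → ℤ) :
    tildeCoord (c • π) L = c * tildeCoord π L := by
  unfold tildeCoord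
  split_ifs
  · simp only [Pi.smul_apply, smul_eq_mul]; ring
  · simp

theorem SatisfiesPlucker.smul {π : YoungDiagram → ℂ} (h : SatisfiesPlucker π) (c : ℂ) :
    SatisfiesPlucker (c • π) := by
  intro k n hkn p hp
  have h0 := h k n hkn p hp
  cases k with
  | zero => exact absurd hp (by simp [pluckerForms])
  | succ m =>
    obtain ⟨I, J, rfl⟩ := hp
    simp only [map_sum, map_mul, map_pow, map_neg, map_one, MvPolynomial.eval_X,
      tildeCoord_smul] at h0 ⊢
    rw [← mul_zero (c ^ 2), ← h0, Finset.mul_sum]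
    refine Finset.sum_congr rfl fun j _ => ?_
    ring

/-- Membership in the infinite Grassmannian does not depend on the homogeneous coordinates. -/
theorem mk_mem_infGrassmannian (π : YoungDiagram → ℂ) (hπ : π ≠ 0) :
    Projectivization.mk ℂ π hπ ∈ InfGrassmannian ↔ SatisfiesPlucker π := by
  obtain ⟨a, ha⟩ := Projectivization.exists_smul_eq_mk_rep ℂ π hπ
  unfold InfGrassmannian
  rw [Set.mem_ofPred_eq, ← ha]
  constructor
  · intro h
    have := h.smul ((a⁻¹ : ℂˣ) : ℂ)
    simpa [Units.smul_def, smul_smul] using this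
  · intro h
    exact h.smul (a : ℂ)

/-! ### Schur functions and the KP τ-function -/

/-- The weight `∑ i · a_i` of the monomial `∏ t_i ^ a_i`. -/
def tWeight (a : ℕ+ →₀ ℕ) : ℕ := a.sum fun i c => (i : ℕ) * c

/-- The complete symmetric function `h_m(t)`, i.e. the coefficient of `z ^ m` in
`exp (∑ t_i z ^ i)`, which is the sum of `∏ t_i ^ a_i / a_i!` over all `a` with `∑ i a_i = m`; it is
zero for `m < 0`. -/
def completeH (m : ℤ) : MvPowerSeries ℕ+ ℂ := fun a =>
  if (tWeight a : ℤ) = m then a.prod (fun _ c => ((c.factorial : ℂ))⁻¹) else 0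

/-- The Schur function `s_λ(t)` (in the normalized power sums `t_i = p_i / i`), by the Jacobi–Trudi
formula `s_λ = det (h_{λ_i - i + j})`. -/
def schur (μ : YoungDiagram) : MvPowerSeries ℕ+ ℂ :=
  Matrix.det (Matrix.of fun i j : Fin (μ.colLen 0) =>
    completeH ((μ.rowLen i : ℤ) - ((i : ℕ) : ℤ) + ((j : ℕ) : ℤ)))

/-- The formal KP τ-function `τ(t) = ∑_λ π_λ s_λ(t)`. The sum is taken coefficientwise; each
coefficient is a finite sum, see `tau_support_finite`. -/
def tauKP (π : YoungDiagram → ℂ) : MvPowerSeries ℕ+ ℂ := fun a =>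
  ∑ᶠ μ : YoungDiagram, π μ * MvPowerSeries.coeff a (schur μ)

/-- `f` is homogeneous of degree `d`. -/
def IsHomog (f : MvPowerSeries ℕ+ ℂ) (d : ℤ) : Prop :=
  ∀ a, MvPowerSeries.coeff a f ≠ 0 → (tWeight a : ℤ) = d

theorem tWeight_add (a b : ℕ+ →₀ ℕ) : tWeight (a + b) = tWeight a + tWeight b := by
  unfold tWeight
  exact Finsupp.sum_add_index' (by simp) (by intros; ring)

theorem isHomog_completeH (m : ℤ) : IsHomog (completeH m) m := by
  intro a ha
  by_contra h
  exact ha (by simp [MvPowerSeries.coeff_apply, completeH, h])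

theorem IsHomog.mul {f g : MvPowerSeries ℕ+ ℂ} {d e : ℤ} (hf : IsHomog f d) (hg : IsHomog g e) :
    IsHomog (f * g) (d + e) := by
  classical
  intro a ha
  rw [MvPowerSeries.coeff_mul] at ha
  obtain ⟨p, hp, hne⟩ := Finset.exists_ne_zero_of_sum_ne_zero ha
  rw [Finset.HasAntidiagonal.mem_antidiagonal] at hp
  rw [← hp, tWeight_add, ← hf _ (left_ne_zero_of_mul hne), ← hg _ (right_ne_zero_of_mul hne)]
  push_cast
  ring

theorem isHomog_prod {ι : Type*} (s : Finset ι) (f : ι → MvPowerSeries ℕ+ ℂ) (d : ι → ℤ)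
    (h : ∀ i ∈ s, IsHomog (f i) (d i)) : IsHomog (∏ i ∈ s, f i) (∑ i ∈ s, d i) := by
  classical
  induction s using Finset.induction_on with
  | empty =>
    intro a ha
    simp only [Finset.prod_empty, MvPowerSeries.coeff_one, ne_eq, ite_eq_right_iff,
      one_ne_zero, imp_false, not_not] at ha
    simp [ha, tWeight]
  | insert i s hi ih =>
    rw [Finset.prod_insert hi, Finset.sum_insert hi]
    exact (h i (by simp)).mul (ih fun j hj => h j (by simp [hj]))

/-- `s_λ` is homogeneous of degree `|λ| = ∑ λ_i`. -/
theorem isHomog_schur (μ : YoungDiagram) :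
    IsHomog (schur μ) (∑ i : Fin (μ.colLen 0), (μ.rowLen i : ℤ)) := by
  intro a ha
  unfold schur at ha
  rw [Matrix.det_apply, map_sum] at ha
  obtain ⟨σ, -, hσ⟩ := Finset.exists_ne_zero_of_sum_ne_zero ha
  have h1 : MvPowerSeries.coeff a (∏ i : Fin (μ.colLen 0),
      completeH ((μ.rowLen (σ i) : ℤ) - ((σ i : ℕ) : ℤ) + ((i : ℕ) : ℤ))) ≠ 0 := by
    intro h0
    apply hσ
    rcases Int.units_eq_one_or (Equiv.Perm.sign σ) with h | h <;>
      simp [h, Units.smul_def, h0]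
  have h2 := isHomog_prod Finset.univ _ _ (fun i _ => isHomog_completeH
    ((μ.rowLen (σ i) : ℤ) - ((σ i : ℕ) : ℤ) + ((i : ℕ) : ℤ))) a h1
  rw [h2, Finset.sum_add_distrib, Finset.sum_sub_distrib,
    Equiv.sum_comp σ (fun i => (μ.rowLen i : ℤ)), Equiv.sum_comp σ (fun i => ((i : ℕ) : ℤ))]
  ring

/-- Every coefficient of `∑_λ π_λ s_λ(t)` is a finite sum. -/
theorem tau_support_finite (π : YoungDiagram → ℂ) (a : ℕ+ →₀ ℕ) :
    (Function.support fun μ : YoungDiagram =>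
      π μ * MvPowerSeries.coeff a (schur μ)).Finite := by
  set d := tWeight a with hd
  have hfin : {μ : YoungDiagram | μ.cells ⊆ Finset.range d ×ˢ Finset.range d}.Finite := by
    refine Set.Finite.of_finite_image (f := YoungDiagram.cells)
      ((Finset.finite_toSet (Finset.powerset (Finset.range d ×ˢ Finset.range d))).subset ?_) ?_
    · rintro _ ⟨μ, hμ, rfl⟩
      exact Finset.mem_coe.mpr (Finset.mem_powerset.mpr hμ)
    · intro μ _ ν _ h
      exact YoungDiagram.ext h
  refine hfin.subset fun μ hμ => ?_
  have hsum : (d : ℤ) = ∑ i : Fin (μ.colLen 0), (μ.rowLen i : ℤ) :=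
    isHomog_schur μ a (right_ne_zero_of_mul hμ)
  have hsum' : d = ∑ i : Fin (μ.colLen 0), μ.rowLen i := by exact_mod_cast hsum
  intro c hc
  have hc' : (c.1, c.2) ∈ μ := hc
  have h0 : (c.1, 0) ∈ μ := μ.up_left_mem le_rfl (Nat.zero_le _) hc'
  have hlt : c.1 < μ.colLen 0 := YoungDiagram.mem_iff_lt_colLen.mp h0
  have hrow : ∀ i : Fin (μ.colLen 0), 1 ≤ μ.rowLen i := fun i =>
    YoungDiagram.mem_iff_lt_rowLen.mp (YoungDiagram.mem_iff_lt_colLen.mpr i.2)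
  have hcol : μ.colLen 0 ≤ d := by
    rw [hsum']
    calc μ.colLen 0 = ∑ _i : Fin (μ.colLen 0), 1 := by simp
      _ ≤ _ := Finset.sum_le_sum fun i _ => hrow i
  have hle : μ.rowLen c.1 ≤ d := by
    rw [hsum']
    exact Finset.single_le_sum (f := fun i : Fin (μ.colLen 0) => μ.rowLen i)
      (fun _ _ => Nat.zero_le _) (Finset.mem_univ ⟨c.1, hlt⟩)
  have h2 : c.2 < μ.rowLen c.1 := YoungDiagram.mem_iff_lt_rowLen.mp hc'
  simp only [Finset.mem_product, Finset.mem_range]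
  omega

/-! ### Lattice evaluations of the τ-function -/

/-- The ring `ℂ[[x, t]]` of formal power series in `x_j` (`j ∈ ℤ`) and `t_i` (`i ≥ 1`). -/
abbrev XT : Type := MvPowerSeries (ℤ ⊕ ℕ+) ℂ

/-- The indeterminate `x_j`. -/
def xVar (j : ℤ) : XT := MvPowerSeries.X (Sum.inl j)

/-- The indeterminate `t_i`. -/
def tVar (i : ℕ+) : XT := MvPowerSeries.X (Sum.inr i)

/-- The family `t + ∑_i n_i [x_i]`, whose `j`-th component is `t_j + ∑_i n_i x_i ^ j / j`. -/
def shiftedT (n : ℤ →₀ ℤ) (j : ℕ+) : XT :=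
  tVar j + n.sum fun i c => ((c : ℂ) / ((j : ℕ) : ℂ)) • xVar i ^ (j : ℕ)

/-- The family `t + ∑_i n_i [x_i]` may be substituted into any power series in `t`. -/
theorem hasSubst_shiftedT (n : ℤ →₀ ℤ) : MvPowerSeries.HasSubst (shiftedT n) := by
  classical
  have hX : MvPowerSeries.HasSubst (fun j : ℕ+ => tVar j) := by
    constructor
    · intro s
      simp [tVar]
    · intro d
      refine Set.Finite.subset
        (Set.Finite.preimage (f := fun j : ℕ+ => (Sum.inr j : ℤ ⊕ ℕ+))
          (fun _ _ _ _ h => Sum.inr_injective h) d.support.finite_toSet) ?_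
      intro j hj
      simp only [tVar, MvPowerSeries.coeff_X, Set.mem_ofPred_eq, ne_eq, ite_eq_right_iff,
        one_ne_zero, imp_false, not_not] at hj
      simp [hj]
  have hP : ∀ (i : ℤ) (c : ℤ), MvPowerSeries.HasSubst
      (fun j : ℕ+ => ((c : ℂ) / ((j : ℕ) : ℂ)) • xVar i ^ (j : ℕ)) := by
    intro i c
    constructor
    · intro s
      simp [xVar, MvPowerSeries.smul_eq_C_mul]
    · intro d
      refine Set.Finite.subset
        (Set.Finite.preimage (f := fun j : ℕ+ => (j : ℕ))
          (fun _ _ _ _ h => PNat.coe_injective h) (Set.finite_singleton (d (Sum.inl i)))) ?_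
      intro j hj
      simp only [xVar, MvPowerSeries.coeff_smul, MvPowerSeries.coeff_X_pow,
        Set.mem_ofPred_eq] at hj
      have : d = Finsupp.single (Sum.inl i) (j : ℕ) := by
        by_contra h
        simp [h] at hj
      simp [this]
  have hS : ∀ s : Finset ℤ, MvPowerSeries.HasSubst
      (fun j : ℕ+ => ∑ i ∈ s, (((n i : ℤ) : ℂ) / ((j : ℕ) : ℂ)) • xVar i ^ (j : ℕ)) := by
    intro s
    induction s using Finset.induction_on with
    | empty => simpa using MvPowerSeries.HasSubst.zero
    | insert i s hi ih =>
      simp only [Finset.sum_insert hi]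
      exact (hP i (n i)).add ih
  exact hX.add (hS n.support)

/-- `f(t + ∑_i n_i [x_i]) ∈ ℂ[[x, t]]` for `f ∈ ℂ[[t]]`. -/
def shiftEval (n : ℤ →₀ ℤ) (f : MvPowerSeries ℕ+ ℂ) : XT :=
  MvPowerSeries.subst (shiftedT n) f

/-- The multiplicative subset generated by the `x_i - x_j`, `i ≠ j`. -/
def Sx : Submonoid XT :=
  Submonoid.closure {p | ∃ i j : ℤ, i ≠ j ∧ p = xVar i - xVar j}

/-- The localization of `ℂ[[x, t]]` at the `x_i - x_j`, `i ≠ j`. -/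
abbrev LocXT : Type := Localization Sx

/-- `x_i - x_j`, for `i ≠ j`, as a unit of the localized ring (and `1` for `i = j`, which is
not used). -/
def xDiff (i j : ℤ) : LocXTˣ :=
  if h : i ≠ j then
    (IsLocalization.map_units LocXT
      (⟨xVar i - xVar j, Submonoid.subset_closure ⟨i, j, h, rfl⟩⟩ : Sx)).unit
  else 1

/-- The normalized lattice evaluation
`H^n(t) = ∏_{i<j} (x_i - x_j) ^ (n_i n_j) · τ(t + ∑_i n_i [x_i])` of the τ-function with Plücker
coordinates `π`. -/
def latticeH (π : YoungDiagram → ℂ) (n : ℤ →₀ ℤ) : LocXT :=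
  ((∏ p ∈ (n.support ×ˢ n.support).filter (fun p => p.1 < p.2),
      xDiff p.1 p.2 ^ (n p.1 * n p.2) : LocXTˣ) : LocXT) *
    algebraMap XT LocXT (shiftEval n (tauKP π))

end KPLattice

end

noncomputable section

namespace KPLattice

/-! ### Complete symmetric functions at shifted times -/

/-! Everything reduces to a Fay identity for $\tau$ with an arbitrary number of points, `tauKP_fay`.

The exponent $n_in_j$ is bilinear, so the prefactor of $H^{\mathbf
n+\alpha_{L_1}+\dots+\alpha_{L_k}}$ splits into a constant, one factor per entry of $L$, and a
product over pairs of entries. Multiplied by $\mathrm{sgn}(L)$, the last becomes a Vandermonde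
product up to a sign depending only on $k$ (`sgn_smul_latticeH`). In a Plücker relation the other
factors are the same in every term, and what remains is Fay's identity.

For Fay's identity, restrict $\tau$ to partitions in a $K\times(n-K)$ box. By Jacobi–Trudi the
shifted truncation is the value of an alternating form with coefficients $\pi_\lambda$ on columns
$l\mapsto h_{l+c}$ (`tauForm_eq_shiftEval`). Newton's recursion gives
$h_m(t+[x])=h_m(t)+x\,h_{m-1}(t+[x])$. Column operations based on it show that a Vandermonde product
times $\tau$ shifted by $k$ points is the form evaluated on $K-k$ fixed columns and one column per
point (`pluckerForm_append_hColumn`). By multilinearity the form satisfies the Plücker relations on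
arbitrary vectors (`pluckerForm_plucker`). Applied to these columns, they are Fay's identity for the
truncation. Truncations agree with $\tau$ up to any prescribed weight, so the identity passes to
$\tau$. -/

theorem completeH_of_neg {m : ℤ} (hm : m < 0) : completeH m = 0 := by
  ext a
  rw [MvPowerSeries.coeff_apply, completeH, if_neg (by omega), map_zero]

theorem tWeight_eq_zero_iff (a : ℕ+ →₀ ℕ) : tWeight a = 0 ↔ a = 0 := by
  constructor
  · intro h
    ext i
    by_contra hi
    have hmem : i ∈ a.support := Finsupp.mem_support_iff.mpr hi
    have := (Finset.sum_eq_zero_iff.mp h) i hmem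
    simp only [mul_eq_zero, PNat.ne_zero, false_or] at this
    exact hi this
  · rintro rfl
    simp [tWeight]

theorem completeH_zero : completeH 0 = 1 := by
  classical
  ext a
  rw [MvPowerSeries.coeff_apply, completeH, MvPowerSeries.coeff_one]
  by_cases h : a = 0
  · subst h
    simp [tWeight]
  · rw [if_neg (by exact_mod_cast mt (tWeight_eq_zero_iff a).mp h), if_neg h]

theorem tWeight_single (i : ℕ+) (c : ℕ) : tWeight (Finsupp.single i c) = i * c := by
  simp [tWeight]

/-- Removing one $t_s$ from the monomial changes $1/a_s!$ into $1/(a_s-1)!=a_s/a_s!$; for $a_s=0$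
both sides vanish. -/
theorem coeff_X_mul_completeH (s : ℕ+) (m : ℤ) (a : ℕ+ →₀ ℕ) :
    MvPowerSeries.coeff a (MvPowerSeries.X s * completeH m) =
      if (tWeight a : ℤ) = m + (s : ℕ) then
        (a s : ℂ) * a.prod (fun _ c => ((c.factorial : ℂ))⁻¹) else 0 := by
  classical
  by_cases hs : a s = 0
  · rw [hs, MvPowerSeries.X, MvPowerSeries.coeff_monomial_mul, if_neg]
    · simp
    · intro h
      simpa [hs] using h s
  · obtain ⟨b, rfl⟩ : ∃ b, a = Finsupp.single s 1 + b := by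
      refine ⟨a - Finsupp.single s 1, ?_⟩
      rw [add_tsub_cancel_of_le]
      rw [Finsupp.single_le_iff]
      omega
    rw [MvPowerSeries.X, MvPowerSeries.coeff_add_monomial_mul, one_mul, MvPowerSeries.coeff_apply,
      completeH, tWeight_add, tWeight_single]
    have hiff : ((tWeight b : ℤ) = m) ↔
        (((s : ℕ) * 1 + tWeight b : ℕ) : ℤ) = m + (s : ℕ) := by
      push_cast; constructor <;> intro h <;> linarith
    simp only [hiff]
    split_ifs with h
    · have hprod : ∀ c : ℕ+ →₀ ℕ, c.prod (fun _ c => ((c.factorial : ℂ))⁻¹) =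
          ((c s).factorial : ℂ)⁻¹ * (c.erase s).prod (fun _ c => ((c.factorial : ℂ))⁻¹) := by
        intro c
        by_cases hc : s ∈ c.support
        · exact (Finsupp.mul_prod_erase c s (fun _ c => ((c.factorial : ℂ))⁻¹) hc).symm
        · have : c s = 0 := by simpa using hc
          rw [this, Finsupp.erase_of_notMem_support hc]
          simp
      rw [hprod b, hprod (Finsupp.single s 1 + b)]
      have he : (Finsupp.single s 1 + b).erase s = b.erase s := by
        rw [Finsupp.erase_add, Finsupp.erase_single, zero_add]
      rw [he]
      simp only [Finsupp.add_apply, Finsupp.single_eq_same]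
      rw [add_comm 1 (b s), Nat.factorial_succ]
      have h1 : ((b s).factorial : ℂ) ≠ 0 := by exact_mod_cast Nat.factorial_ne_zero _
      have h2 : ((b s + 1 : ℕ) : ℂ) ≠ 0 := Nat.cast_ne_zero.mpr (Nat.succ_ne_zero _)
      push_cast at h2 ⊢
      field_simp
    · rfl

/-- Newton's recursion `m h_m = ∑_{i=1}^m i t_i h_{m-i}`. -/
theorem completeH_recursion (m : ℕ) :
    (m : ℂ) • completeH m = ∑ i ∈ Finset.range m,
      (((i + 1 : ℕ) : ℂ) • MvPowerSeries.X i.succPNat) * completeH ((m : ℤ) - (i + 1 : ℕ)) := by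
  classical
  ext a
  rw [map_sum, MvPowerSeries.coeff_smul]
  simp only [smul_mul_assoc, MvPowerSeries.coeff_smul, coeff_X_mul_completeH, Nat.succPNat_coe,
    Nat.succ_eq_add_one, sub_add_cancel]
  rw [MvPowerSeries.coeff_apply, completeH]
  split_ifs with h
  · have h' : tWeight a = m := by exact_mod_cast h
    simp only [← mul_assoc]
    rw [← Finset.sum_mul, ← h']
    congr 1
    -- The coefficients on both sides share the factor $\prod 1/a_i!$. What is left is the
    -- definition of the weight, $m=\sum_i i\,a_i$, where only $i\le m$ occur.
    have himg : a.support ⊆ (Finset.range (tWeight a)).image Nat.succPNat := by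
      intro i hi
      refine Finset.mem_image.mpr ⟨i.natPred, ?_, PNat.succPNat_natPred i⟩
      rw [Finset.mem_range]
      have h1 : (i : ℕ) * a i ≤ tWeight a :=
        Finset.single_le_sum (f := fun i : ℕ+ => (i : ℕ) * a i) (fun _ _ => Nat.zero_le _) hi
      have h2 : 0 < a i := Nat.pos_of_ne_zero (Finsupp.mem_support_iff.mp hi)
      have h3 : (i : ℕ) ≤ (i : ℕ) * a i := Nat.le_mul_of_pos_right _ h2
      have h4 := PNat.natPred_add_one i
      omega
    have hsum : tWeight a = ∑ i ∈ Finset.range (tWeight a), (i + 1) * a i.succPNat := by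
      conv_lhs => rw [tWeight, Finsupp.sum]
      rw [Finset.sum_subset himg, Finset.sum_image]
      · rfl
      · intro i _ j _ hij
        exact Nat.succPNat_injective hij
      · intro i _ hi
        simp [Finsupp.notMem_support_iff.mp hi]
    exact_mod_cast hsum
  · simp

/-- `h_m(t + ∑_i n_i [x_i])`. -/
def shiftedH (N : ℤ →₀ ℤ) (m : ℤ) : XT := shiftEval N (completeH m)

theorem shiftEval_eq (N : ℤ →₀ ℤ) (f : MvPowerSeries ℕ+ ℂ) :
    shiftEval N f = MvPowerSeries.substAlgHom (hasSubst_shiftedT N) f := by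
  rw [shiftEval, MvPowerSeries.coe_substAlgHom]

theorem shiftedH_of_neg (N : ℤ →₀ ℤ) {m : ℤ} (hm : m < 0) : shiftedH N m = 0 := by
  rw [shiftedH, completeH_of_neg hm, shiftEval_eq, map_zero]

theorem shiftedH_zero (N : ℤ →₀ ℤ) : shiftedH N 0 = 1 := by
  rw [shiftedH, completeH_zero, shiftEval_eq, map_one]

/-- The power sum `i t_i`, `i = j + 1`, at shifted times. -/
def shiftedP (N : ℤ →₀ ℤ) (j : ℕ) : XT := ((j + 1 : ℕ) : ℂ) • shiftedT N j.succPNat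

theorem substAlgHom_smul {N : ℤ →₀ ℤ} (c : ℂ) (f : MvPowerSeries ℕ+ ℂ) :
    MvPowerSeries.substAlgHom (R := ℂ) (hasSubst_shiftedT N) (c • f) =
      c • MvPowerSeries.substAlgHom (R := ℂ) (hasSubst_shiftedT N) f :=
  map_smul _ _ _

theorem shiftedH_recursion (N : ℤ →₀ ℤ) (m : ℕ) :
    (m : ℂ) • shiftedH N m =
      ∑ i ∈ Finset.range m, shiftedP N i * shiftedH N ((m : ℤ) - (i + 1 : ℕ)) := by
  have h := congrArg (MvPowerSeries.substAlgHom (R := ℂ) (hasSubst_shiftedT N))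
    (completeH_recursion m)
  rw [map_sum, substAlgHom_smul] at h
  simp only [map_mul, substAlgHom_smul] at h
  simp only [shiftedH, shiftEval_eq, shiftedP]
  rw [h]
  refine Finset.sum_congr rfl fun i _ => ?_
  rw [← MvPowerSeries.subst_X (R := ℂ) (hasSubst_shiftedT N), MvPowerSeries.coe_substAlgHom]

/-- The factor $j+1$ of the power sum cancels the denominator in $[x]=(x,x^2/2,\dots)$. -/
theorem shiftedP_add_single (N : ℤ →₀ ℤ) (i : ℤ) (j : ℕ) :
    shiftedP (N + Finsupp.single i 1) j = shiftedP N j + xVar i ^ (j + 1) := by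
  have h : ((j + 1 : ℕ) : ℂ) ≠ 0 := by exact_mod_cast Nat.succ_ne_zero j
  rw [shiftedP, shiftedP, shiftedT, shiftedT, Finsupp.sum_add_index']
  · rw [Finsupp.sum_single_index]
    · rw [← add_assoc, smul_add, Nat.succPNat_coe, smul_smul]
      congr 1
      rw [Int.cast_one, Nat.succ_eq_add_one, mul_one_div_cancel h, one_smul]
    · simp
  · simp
  · intro a b c
    rw [← add_smul]
    push_cast
    rw [add_div]

/-- A sequence satisfying Newton's recursion is determined by its initial value. -/
theorem eq_of_newton_recursion {R : Type*} [CommRing R] [Algebra ℂ R] (p : ℕ → R) (g h : ℕ → R)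
    (h0 : g 0 = h 0)
    (hg : ∀ m, ((m + 1 : ℕ) : ℂ) • g (m + 1) =
      ∑ i ∈ Finset.range (m + 1), p i * g (m - i))
    (hh : ∀ m, ((m + 1 : ℕ) : ℂ) • h (m + 1) =
      ∑ i ∈ Finset.range (m + 1), p i * h (m - i)) : g = h := by
  funext m
  induction m using Nat.strong_induction_on with
  | _ m ih =>
    cases m with
    | zero => exact h0
    | succ m =>
      have hm : ((m + 1 : ℕ) : ℂ) ≠ 0 := by exact_mod_cast Nat.succ_ne_zero m
      have : ((m + 1 : ℕ) : ℂ) • g (m + 1) = ((m + 1 : ℕ) : ℂ) • h (m + 1) := by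
        rw [hg, hh]
        refine Finset.sum_congr rfl fun i hi => ?_
        rw [ih (m - i) (by omega)]
      have := congrArg (fun z => ((m + 1 : ℕ) : ℂ)⁻¹ • z) this
      simpa only [smul_smul, inv_mul_cancel₀ hm, one_smul] using this

theorem shiftedH_recursion_nat (N : ℤ →₀ ℤ) (m : ℕ) :
    ((m + 1 : ℕ) : ℂ) • shiftedH N ((m + 1 : ℕ) : ℤ) =
      ∑ i ∈ Finset.range (m + 1), shiftedP N i * shiftedH N ((m - i : ℕ) : ℤ) := by
  rw [shiftedH_recursion]
  refine Finset.sum_congr rfl fun i hi => ?_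
  have : i ≤ m := by simpa [Nat.lt_succ_iff] using hi
  congr 2
  push_cast [this]
  ring

/-- `h_m(t + [x]) = h_m(t) + x h_{m-1}(t + [x])`. -/
theorem shiftedH_add_single (N : ℤ →₀ ℤ) (i : ℤ) (m : ℤ) :
    shiftedH (N + Finsupp.single i 1) m =
      shiftedH N m + xVar i * shiftedH (N + Finsupp.single i 1) (m - 1) := by
  set N' := N + Finsupp.single i 1 with hN'
  rcases lt_or_ge m 0 with hm | hm
  · rw [shiftedH_of_neg _ hm, shiftedH_of_neg _ hm, shiftedH_of_neg _ (by omega)]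
    simp
  obtain ⟨m, rfl⟩ := Int.eq_ofNat_of_zero_le hm
  -- Both sequences start at $1$ and satisfy Newton's recursion with the power sums of the unshifted
  -- times.
  suffices h : (fun m : ℕ => shiftedH N' m - xVar i * shiftedH N' ((m : ℤ) - 1)) =
      fun m : ℕ => shiftedH N m by
    exact sub_eq_iff_eq_add.mp (congrFun h m)
  refine eq_of_newton_recursion (shiftedP N) _ _ ?_ ?_ ?_
  · simp only [Nat.cast_zero, shiftedH_zero]
    rw [shiftedH_of_neg _ (by norm_num)]
    simp
  · intro m
    have key : ∀ m : ℕ, ((m + 1 : ℕ) : ℂ) • shiftedH N' ((m + 1 : ℕ) : ℤ) =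
        ∑ j ∈ Finset.range (m + 1), shiftedP N j * shiftedH N' ((m - j : ℕ) : ℤ) +
        ∑ j ∈ Finset.range (m + 1), xVar i ^ (j + 1) * shiftedH N' ((m - j : ℕ) : ℤ) := by
      intro m
      rw [shiftedH_recursion_nat, ← Finset.sum_add_distrib]
      refine Finset.sum_congr rfl fun j _ => ?_
      rw [hN', shiftedP_add_single, add_mul]
    have hcast : (((m + 1 : ℕ) : ℤ) - 1) = (m : ℤ) := by push_cast; ring
    simp only [hcast]
    rw [smul_sub, key]
    cases m with
    | zero =>
      simp only [zero_add, Finset.sum_range_one, Nat.cast_one, one_smul, Nat.cast_zero,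
        Nat.sub_zero, shiftedH_zero]
      rw [shiftedH_of_neg _ (by norm_num)]
      ring
    | succ m =>
      have h1 : ((m + 1 + 1 : ℕ) : ℂ) • (xVar i * shiftedH N' ((m + 1 : ℕ) : ℤ)) =
          xVar i * shiftedH N' ((m + 1 : ℕ) : ℤ) +
            xVar i * (((m + 1 : ℕ) : ℂ) • shiftedH N' ((m + 1 : ℕ) : ℤ)) := by
        rw [Nat.cast_succ (m + 1), add_smul, one_smul, mul_smul_comm, add_comm]
      rw [h1, key]
      -- Splitting off $j=0$ and a factor $x$ turns the geometric sum of degree $m+2$ into the one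
      -- of degree $m+1$, so that the two cancel in the difference.
      have h2 : ∑ j ∈ Finset.range (m + 1 + 1), xVar i ^ (j + 1) *
            shiftedH N' ((m + 1 - j : ℕ) : ℤ) =
          xVar i * shiftedH N' ((m + 1 : ℕ) : ℤ) + xVar i * ∑ j ∈ Finset.range (m + 1),
            xVar i ^ (j + 1) * shiftedH N' ((m - j : ℕ) : ℤ) := by
        rw [Finset.sum_range_succ', Finset.mul_sum, add_comm]
        congr 1
        · simp
        · refine Finset.sum_congr rfl fun j _ => ?_
          rw [Nat.add_sub_add_right]
          ring
      have h3 : ∑ j ∈ Finset.range (m + 1 + 1), shiftedP N j *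
            (shiftedH N' ((m + 1 - j : ℕ) : ℤ) -
              xVar i * shiftedH N' (((m + 1 - j : ℕ) : ℤ) - 1)) =
          ∑ j ∈ Finset.range (m + 1 + 1), shiftedP N j * shiftedH N' ((m + 1 - j : ℕ) : ℤ) -
            xVar i * ∑ j ∈ Finset.range (m + 1), shiftedP N j * shiftedH N' ((m - j : ℕ) : ℤ) := by
        simp only [mul_sub]
        rw [Finset.sum_sub_distrib]
        congr 1
        rw [Finset.sum_range_succ, Nat.sub_self, Nat.cast_zero, shiftedH_of_neg N' (by norm_num),
          mul_zero, mul_zero, add_zero, Finset.mul_sum]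
        refine Finset.sum_congr rfl fun j hj => ?_
        have hj' : j ≤ m := by simpa [Nat.lt_succ_iff] using hj
        have : (((m + 1 - j : ℕ) : ℤ) - 1) = ((m - j : ℕ) : ℤ) := by
          rw [Nat.succ_sub hj']; push_cast; ring
        rw [this]
        ring
      rw [h2, h3]
      ring
  · intro m
    exact shiftedH_recursion_nat N m

/-- `(x - y) h_{m-1}(t + [x] + [y]) = h_m(t + [x]) - h_m(t + [y])`. -/
theorem sub_mul_shiftedH (N : ℤ →₀ ℤ) (i j : ℤ) (m : ℤ) :
    (xVar i - xVar j) * shiftedH (N + Finsupp.single j 1 + Finsupp.single i 1) (m - 1) =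
      shiftedH (N + Finsupp.single i 1) m - shiftedH (N + Finsupp.single j 1) m := by
  have h1 := shiftedH_add_single (N + Finsupp.single j 1) i m
  have h2 := shiftedH_add_single (N + Finsupp.single i 1) j m
  rw [add_right_comm N] at h2
  linear_combination h2 - h1

/-! ### Multilinear forms with Plücker coordinates as coefficients -/

section MultiForm

variable {R ι : Type*} [CommRing R] [Fintype ι]

/-- The multilinear form `∑_L p_L ∏_i f_i(L_i)`. -/
def multiForm {k : ℕ} (p : (Fin k → ι) → R) (f : Fin k → ι → R) : R :=
  ∑ L : Fin k → ι, p L * ∏ i, f i (L i)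

theorem multiForm_snoc {m : ℕ} (p : (Fin (m + 1) → ι) → R) (f : Fin m → ι → R) (v : ι → R) :
    multiForm p (Fin.snoc (α := fun _ => ι → R) f v) =
      ∑ I : Fin m → ι, ∑ a : ι, p (Fin.snoc (α := fun _ => ι) I a) * ((∏ i, f i (I i)) * v a) := by
  rw [multiForm, ← (Fin.snocEquiv (fun _ => ι)).sum_comp, Fintype.sum_prod_type, Finset.sum_comm]
  refine Finset.sum_congr rfl fun I _ => Finset.sum_congr rfl fun a _ => ?_
  simp [Fin.snocEquiv, Fin.prod_univ_castSucc]

/-- Reinserting the removed index at position $j$ makes the weight $\prod f\prod g$ independent of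
$j$. The alternating sum over $j$ then acts on the coefficients alone. -/
theorem multiForm_mul_multiForm {m : ℕ} (p : (Fin (m + 1) → ι) → R) (f : Fin m → ι → R)
    (g : Fin (m + 2) → ι → R) (j : Fin (m + 2)) :
    multiForm p (Fin.snoc (α := fun _ => ι → R) f (g j)) *
        multiForm p (fun a => g (j.succAbove a)) =
      ∑ I : Fin m → ι, ∑ J : Fin (m + 2) → ι,
        (p (Fin.snoc (α := fun _ => ι) I (J j)) * p (fun a => J (j.succAbove a))) *
          ((∏ i, f i (I i)) * ∏ i, g i (J i)) := by
  rw [multiForm_snoc, multiForm, Finset.sum_mul]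
  refine Finset.sum_congr rfl fun I _ => ?_
  rw [← (Fin.insertNthEquiv (fun _ => ι) j).sum_comp, Fintype.sum_prod_type, Finset.sum_mul_sum]
  refine Finset.sum_congr rfl fun a _ => Finset.sum_congr rfl fun K _ => ?_
  simp only [Fin.insertNthEquiv, Equiv.coe_fn_mk, Fin.insertNth_apply_same,
    Fin.insertNth_apply_succAbove, Fin.prod_univ_succAbove _ j]
  ring

theorem multiForm_plucker {m : ℕ} (p : (Fin (m + 1) → ι) → R)
    (hp : ∀ (I : Fin m → ι) (J : Fin (m + 2) → ι), ∑ j : Fin (m + 2), (-1) ^ ((j : ℕ) + 1) *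
      (p (Fin.snoc (α := fun _ => ι) I (J j)) * p (fun a => J (j.succAbove a))) = 0)
    (f : Fin m → ι → R) (g : Fin (m + 2) → ι → R) :
    ∑ j : Fin (m + 2), (-1) ^ ((j : ℕ) + 1) *
      (multiForm p (Fin.snoc (α := fun _ => ι → R) f (g j)) *
        multiForm p (fun a => g (j.succAbove a))) = 0 := by
  simp only [multiForm_mul_multiForm, Finset.mul_sum]
  rw [Finset.sum_comm]
  refine Finset.sum_eq_zero fun I _ => ?_
  rw [Finset.sum_comm]
  refine Finset.sum_eq_zero fun J _ => ?_
  simp only [← mul_assoc]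
  rw [← Finset.sum_mul, ← Finset.sum_mul]
  simp only [mul_assoc]
  rw [hp, zero_mul]

end MultiForm

/-- Strictly increasing tuples. -/
abbrev IncTuple (k n : ℕ) : Type := {S : Fin k → Idx k n // StrictMono S}

theorem IncTuple.strictMono_coe {k n : ℕ} (S : IncTuple k n) :
    StrictMono fun i => (S.1 i : ℤ) := fun _ _ h => S.2 h

/-- The partition of a strictly increasing tuple. -/
def IncTuple.partition {k n : ℕ} (S : IncTuple k n) : YoungDiagram :=
  partitionOf (fun i => (S.1 i : ℤ)) S.strictMono_coe

theorem sort_comp_inv {k : ℕ} {α : Type*} [LinearOrder α] (S : Fin k → α) (hS : StrictMono S)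
    (σ : Equiv.Perm (Fin k)) : Tuple.sort (S ∘ ⇑σ⁻¹) = σ := by
  have hcomp : (S ∘ ⇑σ⁻¹) ∘ σ = S := by
    funext i
    simp
  have h := (Tuple.comp_sort_eq_comp_iff_monotone (f := S ∘ ⇑σ⁻¹) (σ := σ)).mpr
    (by rw [hcomp]; exact hS.monotone)
  have hinj : Function.Injective (S ∘ ⇑σ⁻¹) := hS.injective.comp (σ⁻¹).injective
  ext i
  have := hinj (congrFun h i)
  rw [this]

theorem partitionOf_congr {k : ℕ} {L L' : Fin k → ℤ} (hL : StrictMono L) (hL' : StrictMono L')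
    (h : L = L') : partitionOf L hL = partitionOf L' hL' := by
  subst h
  rfl

theorem tildeCoord_comp_inv (π : YoungDiagram → ℂ) {k n : ℕ} (S : IncTuple k n)
    (σ : Equiv.Perm (Fin k)) :
    tildeCoord π (fun i => (S.1 (σ⁻¹ i) : ℤ)) =
      ((Equiv.Perm.sign σ : ℤ) : ℂ) * π S.partition := by
  have hinj : Function.Injective (fun i => (S.1 (σ⁻¹ i) : ℤ)) :=
    S.strictMono_coe.injective.comp (σ⁻¹).injective
  have hsort : Tuple.sort (fun i => (S.1 (σ⁻¹ i) : ℤ)) = σ :=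
    sort_comp_inv _ S.strictMono_coe σ
  rw [tildeCoord, dif_pos hinj, sgn, if_pos hinj, IncTuple.partition]
  congr 2
  · rw [hsort]
  · apply partitionOf_congr
    rw [hsort]
    funext i
    simp

/-- An injective tuple is $S\circ\sigma^{-1}$ for a unique increasing $S$ and a unique $\sigma$; the
sum over $\sigma$ is the Leibniz expansion of the determinant. -/
theorem multiForm_tildeCoord {R : Type*} [CommRing R] [Algebra ℂ R] (π : YoungDiagram → ℂ)
    {k n : ℕ} (f : Fin k → Idx k n → R) :
    multiForm (fun L : Fin k → Idx k n => algebraMap ℂ R (tildeCoord π fun i => (L i : ℤ))) f =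
      ∑ S : IncTuple k n, algebraMap ℂ R (π S.partition) *
        Matrix.det (Matrix.of fun i j => f i (S.1 j)) := by
  classical
  rw [multiForm]
  have hzero : ∀ L : Fin k → Idx k n, ¬ Function.Injective L →
      algebraMap ℂ R (tildeCoord π fun i => (L i : ℤ)) * ∏ i, f i (L i) = 0 := by
    intro L hL
    rw [tildeCoord, dif_neg, map_zero, zero_mul]
    intro h
    exact hL fun a b hab => h (congrArg Subtype.val hab)
  rw [← Finset.sum_filter_of_ne (p := fun L : Fin k → Idx k n => Function.Injective L)
    (fun L _ hne => by_contra fun h => hne (hzero L h))]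
  simp only [Matrix.det_apply, Finset.mul_sum]
  rw [← Finset.sum_product']
  symm
  refine Finset.sum_bij' (fun (x : IncTuple k n × Equiv.Perm (Fin k)) _ => x.1.1 ∘ ⇑x.2⁻¹)
    (fun L hL => (⟨L ∘ Tuple.sort L, (Tuple.monotone_sort L).strictMono_of_injective
      ((Finset.mem_filter.mp hL).2.comp (Tuple.sort L).injective)⟩, Tuple.sort L))
    ?_ ?_ ?_ ?_ ?_
  · intro x _
    exact Finset.mem_filter.mpr ⟨Finset.mem_univ _, x.1.2.injective.comp (x.2⁻¹).injective⟩
  · intro L _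
    exact Finset.mem_product.mpr ⟨Finset.mem_univ _, Finset.mem_univ _⟩
  · rintro ⟨S, σ⟩ _
    refine Prod.ext (Subtype.ext ?_) (sort_comp_inv S.1 S.2 σ)
    simp only [sort_comp_inv S.1 S.2 σ]
    funext i
    simp
  · intro L _
    funext i
    simp
  · rintro ⟨S, σ⟩ _
    simp only [Function.comp_apply]
    rw [tildeCoord_comp_inv, map_mul, ← (Equiv.prod_comp σ fun i => f i (S.1 (σ⁻¹ i)))]
    simp only [Equiv.Perm.inv_def, Equiv.symm_apply_apply, Matrix.of_apply, Units.smul_def,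
      zsmul_eq_mul, map_intCast]
    ring

/-- The alternating form `∑_S π_S det (f_i (S_j))`, summed over increasing tuples `S`. -/
def pluckerForm (R : Type*) [CommRing R] [Algebra ℂ R] (π : YoungDiagram → ℂ) (k n : ℕ) :
    (Idx k n → R) [⋀^Fin k]→ₗ[R] R :=
  ∑ S : IncTuple k n, algebraMap ℂ R (π S.partition) •
    (Matrix.detRowAlternating (n := Fin k) (R := R)).compLinearMap (LinearMap.funLeft R R S.1)

theorem pluckerForm_apply {R : Type*} [CommRing R] [Algebra ℂ R] (π : YoungDiagram → ℂ) (k n : ℕ)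
    (f : Fin k → Idx k n → R) :
    pluckerForm R π k n f = ∑ S : IncTuple k n, algebraMap ℂ R (π S.partition) *
        Matrix.det (Matrix.of fun i j => f i (S.1 j)) := by
  classical
  have h : ∀ s : Finset (IncTuple k n), (∑ S ∈ s, algebraMap ℂ R (π S.partition) •
      (Matrix.detRowAlternating (n := Fin k) (R := R)).compLinearMap (LinearMap.funLeft R R S.1)) f =
      ∑ S ∈ s, algebraMap ℂ R (π S.partition) * Matrix.det (Matrix.of fun i j => f i (S.1 j)) := by
    intro s
    induction s using Finset.induction_on with
    | empty => rfl
    | insert a s ha ih =>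
      rw [Finset.sum_insert ha, Finset.sum_insert ha, AlternatingMap.add_apply, ih]
      rfl
  exact h Finset.univ

theorem pluckerForm_plucker {R : Type*} [CommRing R] [Algebra ℂ R] {π : YoungDiagram → ℂ}
    (hπ : SatisfiesPlucker π) {m n : ℕ} (hmn : m + 1 ≤ n)
    (f : Fin m → Idx (m + 1) n → R) (g : Fin (m + 2) → Idx (m + 1) n → R) :
    ∑ j : Fin (m + 2), (-1) ^ ((j : ℕ) + 1) *
      (pluckerForm R π (m + 1) n (Fin.snoc (α := fun _ => Idx (m + 1) n → R) f (g j)) *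
        pluckerForm R π (m + 1) n (fun a => g (j.succAbove a))) = 0 := by
  simp only [pluckerForm_apply, ← multiForm_tildeCoord]
  refine multiForm_plucker _ ?_ f g
  intro I J
  have h := hπ (m + 1) n hmn _ ⟨I, J, rfl⟩
  simp only [map_sum, map_mul, map_pow, map_neg, map_one, MvPolynomial.eval_X] at h
  have h2 := congrArg (algebraMap ℂ R) h
  simpa only [map_sum, map_mul, map_pow, map_neg, map_one, map_zero] using h2

/-! ### Column operations in the exterior algebra -/

section Exterior

open ExteriorAlgebra

variable {R M : Type*} [CommRing R] [AddCommGroup M] [Module R M]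

variable (R) in
/-- The product `e_{c+r} ∧ ⋯ ∧ e_{c+1}`. -/
def descProd (e : ℕ → M) : ℕ → ℕ → ExteriorAlgebra R M
  | 0, _ => 1
  | r + 1, c => descProd e r (c + 1) * ι R (e (c + 1))

theorem descProd_succ' (e : ℕ → M) (r c : ℕ) :
    descProd R e (r + 1) c = ι R (e (c + r + 1)) * descProd R e r c := by
  induction r generalizing c with
  | zero => simp [descProd]
  | succ r ih =>
    rw [descProd, ih, descProd, mul_assoc]
    congr 3
    ring_nf

theorem descProd_eq_ιMulti (e : ℕ → M) (r c : ℕ) :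
    descProd R e r c = ιMulti R r (fun a : Fin r => e (c + (r - a))) := by
  induction r with
  | zero => simp [descProd]
  | succ r ih =>
    rw [descProd_succ', ih, ιMulti_succ_apply]
    congr 2
    funext a
    simp [Matrix.vecTail]

theorem ι_mul_ι_swap (u v : M) : ι R u * ι R v = -(ι R v * ι R u) :=
  eq_neg_of_add_eq_zero_left (ι_add_mul_swap u v)

/-- Next to $e_c$ one may replace $e'_{c+1}$ by $e_{c+1}$, since the difference $x\,e_c$ is killed
by $e_c\wedge e_c=0$. The replacement propagates from right to left. -/
theorem descProd_mul_ι (e e' : ℕ → M) (x : R) (h : ∀ c, e (c + 1) = e' (c + 1) + x • e c)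
    (r c : ℕ) : descProd R e' r (c + 1) * ι R (e (c + 1)) = descProd R e (r + 1) c := by
  induction r generalizing c with
  | zero => simp [descProd]
  | succ r ih =>
    rw [descProd, mul_assoc]
    have : ι R (e' (c + 1 + 1)) * ι R (e (c + 1)) = ι R (e (c + 1 + 1)) * ι R (e (c + 1)) := by
      rw [h (c + 1), map_add, map_smul, add_mul, smul_mul_assoc, ι_sq_zero, smul_zero, add_zero]
    rw [this, ← mul_assoc, ih]
    rfl

theorem ι_mul_ιMulti_sub (u : M) {k : ℕ} (v : Fin k → M) :
    ι R u * ιMulti R k v = ι R u * ιMulti R k (fun b => v b - u) := by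
  induction k with
  | zero => simp
  | succ k ih =>
    have h : ι R u * ι R (v 0) = -(ι R (v 0 - u) * ι R u) := by
      rw [← ι_mul_ι_swap, map_sub, mul_sub, ι_sq_zero, sub_zero]
    rw [ιMulti_succ_apply, ιMulti_succ_apply, ← mul_assoc, ← mul_assoc, h, ι_mul_ι_swap u (v 0 - u),
      neg_mul, neg_mul, mul_assoc, mul_assoc, ih]
    rfl

end Exterior

/-- The Vandermonde product `∏_{a<b} (x_{z_b} - x_{z_a})`. -/
def vandProd {k : ℕ} (z : Fin k → ℤ) : XT :=
  ∏ i, ∏ j ∈ Finset.Ioi i, (xVar (z j) - xVar (z i))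

theorem vandProd_succ {k : ℕ} (z : Fin (k + 1) → ℤ) :
    vandProd z = (∏ b : Fin k, (xVar (z b.succ) - xVar (z 0))) * vandProd (fun b => z b.succ) := by
  rw [vandProd, Fin.prod_univ_succ, Fin.prod_Ioi_zero]
  congr 1
  exact Finset.prod_congr rfl fun i _ =>
    Fin.prod_Ioi_succ (fun j => xVar (z j) - xVar (z i.succ)) i

/-- The column `l ↦ h_{l+c}(t + ∑_i n_i [x_i])`. -/
def hColumn (ι : Set ℤ) (N : ℤ →₀ ℤ) (c : ℕ) : ι → XT := fun l => shiftedH N ((l : ℤ) + c)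

theorem hColumn_add_single (ι : Set ℤ) (N : ℤ →₀ ℤ) (i : ℤ) (c : ℕ) :
    hColumn ι (N + Finsupp.single i 1) (c + 1) =
      hColumn ι N (c + 1) + xVar i • hColumn ι (N + Finsupp.single i 1) c := by
  funext l
  simp only [hColumn, Pi.add_apply, Pi.smul_apply, smul_eq_mul]
  rw [shiftedH_add_single]
  congr 3
  push_cast
  ring

theorem hColumn_sub (ι : Set ℤ) (N : ℤ →₀ ℤ) (i j : ℤ) (c : ℕ) :
    hColumn ι (N + Finsupp.single i 1) (c + 1) - hColumn ι (N + Finsupp.single j 1) (c + 1) =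
      (xVar i - xVar j) • hColumn ι (N + Finsupp.single j 1 + Finsupp.single i 1) c := by
  funext l
  simp only [hColumn, Pi.sub_apply, Pi.smul_apply, smul_eq_mul]
  rw [← sub_mul_shiftedH]
  congr 2
  push_cast
  ring

/-- Induction on the number of points. Subtracting the column of $z_0$ from the other point columns
leaves $x_{z_b}-x_{z_0}$ times columns shifted by both points, of index one lower. The column of
$z_0$ itself is absorbed into the descending product, which thereby acquires the shift by $z_0$. -/
theorem descProd_mul_ιMulti_hColumn (ι : Set ℤ) (k r : ℕ) (N : ℤ →₀ ℤ) (z : Fin k → ℤ) :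
    descProd XT (hColumn ι N) r k * ExteriorAlgebra.ιMulti XT k
        (fun b => hColumn ι (N + Finsupp.single (z b) 1) k) =
      vandProd z • descProd XT (hColumn ι (N + ∑ b, Finsupp.single (z b) 1)) (r + k) 0 := by
  induction k generalizing r N with
  | zero => simp [vandProd]
  | succ k ih =>
    rw [ExteriorAlgebra.ιMulti_succ_apply, ι_mul_ιMulti_sub]
    have h1 : (fun b => Matrix.vecTail (fun b => hColumn ι (N + Finsupp.single (z b) 1) (k + 1)) b -
        hColumn ι (N + Finsupp.single (z 0) 1) (k + 1)) =
        fun b : Fin k => (xVar (z b.succ) - xVar (z 0)) •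
          hColumn ι (N + Finsupp.single (z 0) 1 + Finsupp.single (z b.succ) 1) k := by
      funext b
      rw [← hColumn_sub]
      rfl
    rw [h1, AlternatingMap.map_smul_univ, mul_smul_comm, mul_smul_comm, ← mul_assoc,
      descProd_mul_ι _ _ (xVar (z 0)) (hColumn_add_single ι N (z 0)), ih, smul_smul, vandProd_succ,
      Fin.sum_univ_succ, ← add_assoc, Nat.succ_add_eq_add_succ]

/-- The linear extension of an alternating form to the exterior algebra. -/
def liftForm {R M : Type*} [CommRing R] [AddCommGroup M] [Module R M] {K : ℕ}
    (P : M [⋀^Fin K]→ₗ[R] R) : ExteriorAlgebra R M →ₗ[R] R :=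
  ExteriorAlgebra.liftAlternating (Pi.single K P)

theorem liftForm_ιMulti {R M : Type*} [CommRing R] [AddCommGroup M] [Module R M] {K : ℕ}
    (P : M [⋀^Fin K]→ₗ[R] R) (v : Fin K → M) :
    liftForm P (ExteriorAlgebra.ιMulti R K v) = P v := by
  rw [liftForm, ExteriorAlgebra.liftAlternating_apply_ιMulti, Pi.single_eq_same]

/-- The alternating form evaluated on the columns of complete symmetric functions. -/
def tauForm (π : YoungDiagram → ℂ) (K n : ℕ) (N : ℤ →₀ ℤ) : XT :=
  pluckerForm XT π K n (fun a => hColumn _ N (K - a))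

theorem pluckerForm_append_hColumn (π : YoungDiagram → ℂ) (r k n : ℕ) (N : ℤ →₀ ℤ)
    (z : Fin k → ℤ) :
    pluckerForm XT π (r + k) n (Fin.append (fun a : Fin r => hColumn _ N (k + (r - a)))
        (fun b => hColumn _ (N + Finsupp.single (z b) 1) k)) =
      vandProd z * tauForm π (r + k) n (N + ∑ b, Finsupp.single (z b) 1) := by
  have h := descProd_mul_ιMulti_hColumn
    (Set.Icc (-((r + k : ℕ) : ℤ)) ((n : ℤ) - ((r + k : ℕ) : ℤ) - 1)) k r N z
  rw [descProd_eq_ιMulti, descProd_eq_ιMulti, ExteriorAlgebra.ιMulti_mul_ιMulti] at h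
  have h2 := congrArg (liftForm (pluckerForm XT π (r + k) n)) h
  rw [map_smul, liftForm_ιMulti, liftForm_ιMulti] at h2
  rw [h2, tauForm, smul_eq_mul]
  simp only [zero_add]

/-- This is the Plücker relation for $w,y$ and $w,z$: exchanging a vector of the common block $w$
repeats it in the first factor, so only exchanges of the $z_j$ survive. -/
theorem plucker_append {R M : Type*} [CommRing R] [AddCommGroup M] [Module R M] {r m : ℕ}
    (P : M [⋀^Fin (r + (m + 1))]→ₗ[R] R)
    (hP : ∀ (f : Fin (r + m) → M) (g : Fin (r + m + 2) → M),
      ∑ j : Fin (r + m + 2), (-1) ^ ((j : ℕ) + 1) *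
        (P (Fin.snoc (n := r + m) (α := fun _ => M) f (g j)) *
          P (fun a : Fin (r + m + 1) => g (j.succAbove a))) = 0)
    (w : Fin r → M) (y : Fin m → M) (z : Fin (m + 2) → M) :
    ∑ j : Fin (m + 2), (-1) ^ ((j : ℕ) + 1) *
      (P (Fin.append w (Fin.snoc (α := fun _ => M) y (z j))) *
        P (Fin.append w (fun a => z (j.succAbove a)))) = 0 := by
  have h := hP (Fin.append w y) (Fin.append (m := r) (n := m + 2) w z)
  change ∑ j : Fin (r + (m + 2)), _ = _ at h
  rw [Fin.sum_univ_add] at h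
  have h0 : ∀ i : Fin r, P (Fin.snoc (α := fun _ => M) (Fin.append w y) (w i)) = 0 := by
    intro i
    refine P.map_eq_zero_of_eq _ (i := Fin.castSucc (Fin.castAdd m i)) (j := Fin.last _) ?_
      (Fin.castSucc_lt_last _).ne
    rw [Fin.snoc_castSucc, Fin.snoc_last, Fin.append_left]
  have h1 : ∀ j : Fin (m + 2), (fun a : Fin (r + m + 1) =>
      Fin.append (m := r) (n := m + 2) w z ((Fin.natAdd r j : Fin (r + m + 2)).succAbove a)) =
      Fin.append w (fun a : Fin (m + 1) => z (j.succAbove a)) := by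
    intro j
    funext a
    refine Fin.addCases (m := r) (n := m + 1) (fun i => ?_) (fun i => ?_) a
    · rw [Fin.append_left]
      have : (Fin.natAdd r j : Fin (r + m + 2)).succAbove (Fin.castAdd (m + 1) i) =
          Fin.castAdd (m + 2) i := by
        rw [Fin.succAbove_of_castSucc_lt]
        · rfl
        · rw [Fin.lt_def]
          simp
          omega
      rw [this, Fin.append_left]
    · rw [Fin.append_right]
      have : (Fin.natAdd r j : Fin (r + m + 2)).succAbove (Fin.natAdd r i) =
          Fin.natAdd r (j.succAbove i) := by
        rcases lt_or_ge i.castSucc j with hij | hij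
        · rw [Fin.succAbove_of_castSucc_lt j i hij, Fin.succAbove_of_castSucc_lt]
          · rfl
          · rw [Fin.lt_def] at hij ⊢
            simp at hij ⊢
            omega
        · rw [Fin.succAbove_of_le_castSucc j i hij, Fin.succAbove_of_le_castSucc]
          · rfl
          · rw [Fin.le_def] at hij ⊢
            simp at hij ⊢
            omega
      rw [this, Fin.append_right]
  simp only [Fin.append_left, Fin.append_right, h0, zero_mul, mul_zero, Finset.sum_const_zero,
    zero_add, h1, Fin.val_natAdd] at h
  -- The position of $z_j$ is shifted by the length $r$ of $w$, which costs a global sign $(-1)^r$.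
  have hu : ((-1 : R) ^ r) * (-1) ^ r = 1 := by
    rw [← mul_pow]; simp
  have h2 := congrArg (fun t => (-1 : R) ^ r * t) h
  simp only [Finset.mul_sum, mul_zero] at h2
  rw [← h2]
  refine Finset.sum_congr rfl fun j _ => ?_
  rw [Fin.append_snoc, add_assoc r, pow_add _ r, mul_assoc ((-1 : R) ^ r),
    ← mul_assoc ((-1 : R) ^ r) ((-1) ^ r), hu, one_mul]

/-- Fay's identity for the truncated τ-functions. -/
theorem tauForm_fay {π : YoungDiagram → ℂ} (hπ : SatisfiesPlucker π) {r m n : ℕ}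
    (hn : r + m + 1 ≤ n) (N : ℤ →₀ ℤ) (y : Fin m → ℤ) (z : Fin (m + 2) → ℤ) :
    ∑ j : Fin (m + 2), (-1) ^ ((j : ℕ) + 1) *
      ((vandProd (Fin.snoc (α := fun _ => ℤ) y (z j)) * tauForm π (r + m + 1) n
          (N + ∑ b, Finsupp.single (Fin.snoc (α := fun _ => ℤ) y (z j) b) 1)) *
        (vandProd (fun a => z (j.succAbove a)) * tauForm π (r + m + 1) n
          (N + ∑ b, Finsupp.single (z (j.succAbove b)) 1))) = 0 := by
  have h := plucker_append (r := r) (m := m) (pluckerForm XT π (r + m + 1) n) (pluckerForm_plucker hπ hn)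
    (fun a : Fin r => hColumn _ N (m + 1 + (r - a)))
    (fun b => hColumn _ (N + Finsupp.single (y b) 1) (m + 1))
    (fun b => hColumn _ (N + Finsupp.single (z b) 1) (m + 1))
  rw [← h]
  refine Finset.sum_congr rfl fun j _ => ?_
  have h1 := pluckerForm_append_hColumn π r (m + 1) n N (Fin.snoc (α := fun _ => ℤ) y (z j))
  have h2 := pluckerForm_append_hColumn π r (m + 1) n N (fun a => z (j.succAbove a))
  congr 2
  · refine h1.symm.trans ?_
    congr 2
    funext b
    refine Fin.lastCases ?_ (fun b => ?_) b
    · rw [Fin.snoc_last, Fin.snoc_last]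
      rfl
    · rw [Fin.snoc_castSucc, Fin.snoc_castSucc]
      rfl
  · exact h2.symm

/-! ### Truncations of the τ-function -/

theorem rowLen_eq_zero {μ : YoungDiagram} {i : ℕ} (hi : μ.colLen 0 ≤ i) : μ.rowLen i = 0 := by
  by_contra h
  have h1 : (i, 0) ∈ μ := YoungDiagram.mem_iff_lt_rowLen.mpr (Nat.pos_of_ne_zero h)
  have h2 := YoungDiagram.mem_iff_lt_colLen.mp h1
  omega

/-- The Jacobi–Trudi determinant does not change when empty rows are added. -/
theorem schur_eq_det (μ : YoungDiagram) {K : ℕ} (hK : μ.colLen 0 ≤ K) :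
    schur μ = Matrix.det (Matrix.of fun i j : Fin K =>
      completeH ((μ.rowLen i : ℤ) - ((i : ℕ) : ℤ) + ((j : ℕ) : ℤ))) := by
  induction K, hK using Nat.le_induction with
  | base => rfl
  | succ K hK ih =>
    -- The added row has entries $h_{j-K}$, hence is $(0,\dots,0,1)$.
    rw [ih, Matrix.det_succ_row _ (Fin.last K), Finset.sum_eq_single (Fin.last K)]
    · simp only [Matrix.of_apply, Fin.val_last, rowLen_eq_zero hK, Fin.succAbove_last]
      rw [← two_mul, pow_mul]
      simp only [neg_one_sq, one_pow, one_mul, Nat.cast_zero, zero_sub, neg_add_cancel,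
        completeH_zero]
      rfl
    · intro j _ hj
      have hlt : (j : ℕ) < K := by
        have := Fin.lt_last_iff_ne_last.mpr hj
        exact this
      rw [Matrix.of_apply, Fin.val_last, rowLen_eq_zero hK, completeH_of_neg]
      · ring
      · push_cast; omega
    · intro h
      exact absurd (Finset.mem_univ _) h

theorem IncTuple.le_coe {K n : ℕ} (S : IncTuple K n) (a : Fin K) :
    ((a : ℕ) : ℤ) - K ≤ (S.1 a : ℤ) := by
  obtain ⟨a, ha⟩ := a
  induction a with
  | zero =>
    have := (S.1 ⟨0, ha⟩).2.1
    simpa using this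
  | succ a ih =>
    have h1 := ih (by omega)
    have h2 := S.strictMono_coe (a := ⟨a, by omega⟩) (b := ⟨a + 1, ha⟩)
      (by rw [Fin.lt_def]; simp)
    simp only at h1 h2 ⊢
    push_cast
    omega

theorem IncTuple.mem_partition {K n : ℕ} (S : IncTuple K n) (i j : ℕ) :
    (i, j) ∈ S.partition ↔ ∃ h : i < K, (j : ℤ) < (S.1 (Fin.rev ⟨i, h⟩) : ℤ) + i + 1 := by
  rw [IncTuple.partition, partitionOf, YoungDiagram.mem_ofRowLens]
  simp only [List.length_ofFn, List.getElem_ofFn, Int.lt_toNat]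

theorem IncTuple.colLen_partition_le {K n : ℕ} (S : IncTuple K n) : S.partition.colLen 0 ≤ K := by
  by_contra h
  have h1 := YoungDiagram.mem_iff_lt_colLen.mpr (not_le.mp h)
  obtain ⟨h2, -⟩ := (S.mem_partition _ _).mp h1
  omega

theorem IncTuple.rowLen_partition {K n : ℕ} (S : IncTuple K n) (i : Fin K) :
    (S.partition.rowLen i : ℤ) = (S.1 (Fin.rev i) : ℤ) + (i : ℕ) + 1 := by
  have h0 := S.le_coe (Fin.rev i)
  rw [Fin.val_rev] at h0
  have hi := i.2
  -- Nonnegativity ensures that `toNat` in `partitionOf` truncates nothing.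
  have hnn : 0 ≤ (S.1 (Fin.rev i) : ℤ) + (i : ℕ) + 1 := by
    push_cast [Nat.succ_le_of_lt hi] at h0
    omega
  obtain ⟨r, hr⟩ := Int.eq_ofNat_of_zero_le hnn
  rw [hr]
  have key : ∀ j : ℕ, j < S.partition.rowLen i ↔ j < r := by
    intro j
    rw [← YoungDiagram.mem_iff_lt_rowLen, S.mem_partition]
    constructor
    · rintro ⟨_, h⟩
      have : (j : ℤ) < r := by rw [Fin.eta, hr] at h; exact h
      exact_mod_cast this
    · intro h
      refine ⟨hi, ?_⟩
      rw [Fin.eta, hr]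
      exact_mod_cast h
  have : S.partition.rowLen i = r := by
    apply le_antisymm
    · by_contra h
      exact absurd ((key r).mp (not_le.mp h)) (lt_irrefl _)
    · by_contra h
      exact absurd ((key _).mpr (not_le.mp h)) (lt_irrefl _)
  rw [this]

theorem IncTuple.partition_injective (K n : ℕ) :
    Function.Injective (IncTuple.partition : IncTuple K n → YoungDiagram) := by
  intro S T h
  apply Subtype.ext
  funext a
  apply Subtype.ext
  have h1 := S.rowLen_partition (Fin.rev a)
  have h2 := T.rowLen_partition (Fin.rev a)
  rw [Fin.rev_rev] at h1 h2
  rw [h] at h1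
  linarith

theorem IncTuple.exists_partition_eq {K n : ℕ} {μ : YoungDiagram} (h1 : μ.colLen 0 ≤ K)
    (h2 : μ.rowLen 0 + K ≤ n) : ∃ S : IncTuple K n, S.partition = μ := by
  have hmono : StrictMono fun a : Fin K =>
      (μ.rowLen (Fin.rev a) : ℤ) - ((Fin.rev a : Fin K) : ℕ) - 1 := by
    intro a b hab
    have h := μ.rowLen_anti (Fin.rev b) (Fin.rev a) (Fin.rev_le_rev.mpr hab.le)
    have h' : Fin.rev b < Fin.rev a := Fin.rev_lt_rev.mpr hab
    rw [Fin.lt_def] at h'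
    simp only
    omega
  refine ⟨⟨fun a => ⟨(μ.rowLen (Fin.rev a) : ℤ) - ((Fin.rev a : Fin K) : ℕ) - 1, ?_, ?_⟩,
    fun a b hab => hmono hab⟩, ?_⟩
  · have := (Fin.rev a).2
    omega
  · have := μ.rowLen_anti 0 (Fin.rev a) (Nat.zero_le _)
    omega
  · ext ⟨i, j⟩
    rw [YoungDiagram.mem_cells, YoungDiagram.mem_cells, IncTuple.mem_partition]
    rw [YoungDiagram.mem_iff_lt_rowLen]
    simp only [Fin.rev_rev]
    constructor
    · rintro ⟨_, h⟩
      omega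
    · intro h
      refine ⟨?_, by omega⟩
      by_contra hi
      rw [rowLen_eq_zero (by omega)] at h
      omega

/-- The sum `∑_λ π_λ s_λ` over the partitions in the box of size `k × (n - k)`. -/
def tauTrunc (π : YoungDiagram → ℂ) (K n : ℕ) : MvPowerSeries ℕ+ ℂ :=
  ∑ S : IncTuple K n, MvPowerSeries.C (π S.partition) * schur S.partition

theorem tauForm_eq_shiftEval (π : YoungDiagram → ℂ) (K n : ℕ) (N : ℤ →₀ ℤ) :
    tauForm π K n N = shiftEval N (tauTrunc π K n) := by
  rw [tauForm, pluckerForm_apply, tauTrunc, shiftEval_eq, map_sum]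
  refine Finset.sum_congr rfl fun S _ => ?_
  rw [map_mul]
  congr 1
  · rw [MvPowerSeries.c_eq_algebraMap, AlgHom.commutes]
  -- Transposing and reversing both index sets matches the matrices: `S.1 (Fin.rev i)` is
  -- $\lambda_i-i-1$ and $K-\mathrm{rev}(j)=j+1$ (counting from $0$), so the entry is
  -- $h_{\lambda_i-i+j}$.
  · rw [schur_eq_det _ S.colLen_partition_le, AlgHom.map_det, ← Matrix.det_transpose,
      ← Matrix.det_submatrix_equiv_self Fin.revPerm]
    congr 1
    ext1 i j
    simp only [Matrix.submatrix_apply, Matrix.transpose_apply, Matrix.of_apply, hColumn,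
      AlgHom.mapMatrix_apply, Matrix.map_apply, shiftedH, shiftEval_eq, Fin.revPerm_apply]
    rw [S.rowLen_partition]
    congr 2
    have := j.2
    rw [Fin.val_rev]
    push_cast [Nat.sub_sub_self (Nat.succ_le_of_lt this)]
    ring

/-- Only partitions of size equal to the weight of `a` contribute. They have at most $d$ rows and
columns, hence fit in the $K\times(n-K)$ box. -/
theorem coeff_tauTrunc (π : YoungDiagram → ℂ) {K n d : ℕ} (hK : d ≤ K) (hn : d + K ≤ n)
    {a : ℕ+ →₀ ℕ} (ha : tWeight a ≤ d) :
    MvPowerSeries.coeff a (tauTrunc π K n) = MvPowerSeries.coeff a (tauKP π) := by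
  classical
  rw [MvPowerSeries.coeff_apply (tauKP π), tauKP,
    finsum_eq_sum_of_support_subset (s := Finset.univ.image (IncTuple.partition (k := K) (n := n))),
    Finset.sum_image fun _ _ _ _ h => IncTuple.partition_injective K n h, tauTrunc, map_sum]
  · exact Finset.sum_congr rfl fun S _ => MvPowerSeries.coeff_C_mul _ _ _
  · intro μ hμ
    have hsum : (tWeight a : ℤ) = ∑ i : Fin (μ.colLen 0), (μ.rowLen i : ℤ) :=
      isHomog_schur μ a (right_ne_zero_of_mul hμ)
    have hsum' : tWeight a = ∑ i : Fin (μ.colLen 0), μ.rowLen i := by exact_mod_cast hsum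
    have hrow : ∀ i : Fin (μ.colLen 0), 1 ≤ μ.rowLen i := fun i =>
      YoungDiagram.mem_iff_lt_rowLen.mp (YoungDiagram.mem_iff_lt_colLen.mpr i.2)
    have hcol : μ.colLen 0 ≤ d := by
      refine le_trans ?_ ha
      rw [hsum']
      calc μ.colLen 0 = ∑ _i : Fin (μ.colLen 0), 1 := by simp
        _ ≤ _ := Finset.sum_le_sum fun i _ => hrow i
    have hle : μ.rowLen 0 ≤ d := by
      rcases Nat.eq_zero_or_pos (μ.colLen 0) with h | h
      · rw [rowLen_eq_zero h.le]
        exact Nat.zero_le _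
      · refine le_trans ?_ ha
        rw [hsum']
        exact Finset.single_le_sum (f := fun i : Fin (μ.colLen 0) => μ.rowLen i)
          (fun _ _ => Nat.zero_le _) (Finset.mem_univ ⟨0, h⟩)
    obtain ⟨S, hS⟩ := IncTuple.exists_partition_eq (K := K) (n := n) (μ := μ) (by omega) (by omega)
    rw [Finset.coe_image]
    exact ⟨S, Finset.mem_coe.mpr (Finset.mem_univ _), hS⟩

/-! ### Weight filtration -/

/-- The weights `1` of `x_j` and `i` of `t_i`. -/
def xtWeight : ℤ ⊕ ℕ+ → ℕ := Sum.elim (fun _ => 1) (fun i => i)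

/-- The ideal of power series all of whose monomials have weight greater than `d`. -/
def weightIdeal (d : ℕ) : Ideal XT where
  carrier := {f | ∀ e, Finsupp.weight xtWeight e ≤ d → MvPowerSeries.coeff e f = 0}
  add_mem' hf hg e he := by rw [map_add, hf e he, hg e he, add_zero]
  zero_mem' e _ := map_zero _
  smul_mem' c f hf e he := by
    classical
    rw [smul_eq_mul, MvPowerSeries.coeff_mul]
    refine Finset.sum_eq_zero fun p hp => ?_
    rw [Finset.HasAntidiagonal.mem_antidiagonal] at hp
    rw [← hp, map_add] at he
    rw [hf p.2 (by omega), mul_zero]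

theorem le_weightedOrder_shiftedT (N : ℤ →₀ ℤ) (j : ℕ+) :
    ((j : ℕ) : ℕ∞) ≤ (shiftedT N j).weightedOrder xtWeight := by
  classical
  refine MvPowerSeries.le_weightedOrder _ fun e he => ?_
  have he' : Finsupp.weight xtWeight e < (j : ℕ) := by exact_mod_cast he
  rw [shiftedT, map_add, Finsupp.sum, map_sum, tVar, MvPowerSeries.coeff_X, if_neg, zero_add]
  · refine Finset.sum_eq_zero fun i _ => ?_
    rw [MvPowerSeries.coeff_smul, xVar, MvPowerSeries.coeff_X_pow, if_neg, mul_zero]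
    rintro rfl
    simp [Finsupp.weight_single, xtWeight] at he'
  · rintro rfl
    simp [Finsupp.weight_single, xtWeight] at he'

/-- Each monomial of the series substituted for $t_j$ has weight $j$, so substitution does not lower
weights. -/
theorem shiftEval_mem_weightIdeal (N : ℤ →₀ ℤ) {d : ℕ} {f : MvPowerSeries ℕ+ ℂ}
    (hf : ∀ a, tWeight a ≤ d → MvPowerSeries.coeff a f = 0) : shiftEval N f ∈ weightIdeal d := by
  intro e he
  apply MvPowerSeries.coeff_eq_zero_of_lt_weightedOrder xtWeight
  have h1 : ((d + 1 : ℕ) : ℕ∞) ≤ (shiftEval N f).weightedOrder xtWeight := by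
    refine le_trans ?_ (MvPowerSeries.le_weightedOrder_subst xtWeight (hasSubst_shiftedT N) f)
    refine le_iInf₂ fun a ha => ?_
    have hda : d + 1 ≤ tWeight a := by
      by_contra h
      exact ha (hf a (by omega))
    refine le_trans (Nat.cast_le.mpr hda) ?_
    rw [tWeight, Finsupp.weight_apply, Finsupp.sum, Finsupp.sum, Nat.cast_sum]
    refine Finset.sum_le_sum fun i _ => ?_
    rw [mul_comm, Nat.cast_mul, nsmul_eq_mul]
    exact mul_le_mul_right (le_weightedOrder_shiftedT N i) _
  refine lt_of_lt_of_le ?_ h1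
  exact_mod_cast Nat.lt_succ_of_le he

theorem mk_shiftEval_tauKP (π : YoungDiagram → ℂ) {K n d : ℕ} (hK : d ≤ K) (hn : d + K ≤ n)
    (N : ℤ →₀ ℤ) :
    Ideal.Quotient.mk (weightIdeal d) (shiftEval N (tauKP π)) =
      Ideal.Quotient.mk (weightIdeal d) (tauForm π K n N) := by
  rw [tauForm_eq_shiftEval, Ideal.Quotient.eq, shiftEval_eq, shiftEval_eq, ← map_sub,
    ← shiftEval_eq]
  refine shiftEval_mem_weightIdeal N fun a ha => ?_
  rw [map_sub, coeff_tauTrunc π hK hn ha, sub_self]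

theorem eq_zero_of_forall_mk {f : XT} (h : ∀ d, Ideal.Quotient.mk (weightIdeal d) f = 0) :
    f = 0 := by
  ext e
  rw [map_zero]
  exact Ideal.Quotient.eq_zero_iff_mem.mp (h (Finsupp.weight xtWeight e)) e le_rfl

/-- Fay's identity for the KP τ-function. -/
theorem tauKP_fay {π : YoungDiagram → ℂ} (hπ : SatisfiesPlucker π) {m : ℕ} (N : ℤ →₀ ℤ)
    (y : Fin m → ℤ) (z : Fin (m + 2) → ℤ) :
    ∑ j : Fin (m + 2), (-1) ^ ((j : ℕ) + 1) *
      ((vandProd (Fin.snoc (α := fun _ => ℤ) y (z j)) *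
          shiftEval (N + ∑ b, Finsupp.single (Fin.snoc (α := fun _ => ℤ) y (z j) b) 1) (tauKP π)) *
        (vandProd (fun a => z (j.succAbove a)) *
          shiftEval (N + ∑ b, Finsupp.single (z (j.succAbove b)) 1) (tauKP π))) = 0 := by
  refine eq_zero_of_forall_mk fun d => ?_
  -- With $r=d$ fixed columns the box has $K=d+m+1$ rows and $n-K=d$ columns, enough for all weights
  -- up to $d$.
  have h := congrArg (Ideal.Quotient.mk (weightIdeal d))
    (tauForm_fay hπ (r := d) (n := d + (d + m + 1)) (by omega) N y z)
  rw [← h.trans (map_zero _)]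
  simp only [map_sum, map_mul]
  refine Finset.sum_congr rfl fun j _ => ?_
  rw [mk_shiftEval_tauKP π (K := d + m + 1) (n := d + (d + m + 1)) (by omega) le_rfl,
    mk_shiftEval_tauKP π (K := d + m + 1) (n := d + (d + m + 1)) (by omega) le_rfl]

/-! ### The prefactors of lattice evaluations -/

/-- The bimultiplicative pairing `∏_{i<j} (x_i - x_j) ^ (n_i m_j)`, `i, j ∈ s`. -/
def xPairing (s : Finset ℤ) (n m : ℤ →₀ ℤ) : LocXTˣ :=
  ∏ p ∈ (s ×ˢ s).filter (fun p => p.1 < p.2), xDiff p.1 p.2 ^ (n p.1 * m p.2)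

theorem xPairing_add_left (s : Finset ℤ) (n n' m : ℤ →₀ ℤ) :
    xPairing s (n + n') m = xPairing s n m * xPairing s n' m := by
  simp only [xPairing, ← Finset.prod_mul_distrib]
  refine Finset.prod_congr rfl fun p _ => ?_
  rw [Finsupp.add_apply, add_mul, zpow_add]

theorem xPairing_add_right (s : Finset ℤ) (n m m' : ℤ →₀ ℤ) :
    xPairing s n (m + m') = xPairing s n m * xPairing s n m' := by
  simp only [xPairing, ← Finset.prod_mul_distrib]
  refine Finset.prod_congr rfl fun p _ => ?_
  rw [Finsupp.add_apply, mul_add, zpow_add]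

theorem xPairing_sum_left {ι : Type*} (s : Finset ℤ) (u : Finset ι) (n : ι → ℤ →₀ ℤ)
    (m : ℤ →₀ ℤ) : xPairing s (∑ a ∈ u, n a) m = ∏ a ∈ u, xPairing s (n a) m := by
  classical
  induction u using Finset.induction_on with
  | empty => simp [xPairing]
  | insert a u ha ih => rw [Finset.sum_insert ha, Finset.prod_insert ha, xPairing_add_left, ih]

theorem xPairing_sum_right {ι : Type*} (s : Finset ℤ) (u : Finset ι) (n : ℤ →₀ ℤ)
    (m : ι → ℤ →₀ ℤ) : xPairing s n (∑ a ∈ u, m a) = ∏ a ∈ u, xPairing s n (m a) := by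
  classical
  induction u using Finset.induction_on with
  | empty => simp [xPairing]
  | insert a u ha ih => rw [Finset.sum_insert ha, Finset.prod_insert ha, xPairing_add_right, ih]

theorem xPairing_single (s : Finset ℤ) {i j : ℤ} (hi : i ∈ s) (hj : j ∈ s) :
    xPairing s (Finsupp.single i 1) (Finsupp.single j 1) = if i < j then xDiff i j else 1 := by
  classical
  have hne : ∀ p : ℤ × ℤ, p ≠ (i, j) →
      xDiff p.1 p.2 ^ ((Finsupp.single i (1 : ℤ)) p.1 * (Finsupp.single j (1 : ℤ)) p.2) = 1 := by
    intro p hp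
    by_cases h1 : i = p.1
    · have h2 : j ≠ p.2 := fun h2 => hp (Prod.ext h1.symm h2.symm)
      rw [Finsupp.single_apply (a := j), if_neg h2, mul_zero, zpow_zero]
    · rw [Finsupp.single_apply, if_neg h1, zero_mul, zpow_zero]
  split_ifs with h
  · rw [xPairing, Finset.prod_eq_single (i, j) (fun p _ hp => hne p hp)]
    · simp
    · intro hmem
      exact absurd (Finset.mem_filter.mpr ⟨Finset.mk_mem_product hi hj, h⟩) hmem
  · refine Finset.prod_eq_one fun p hp => hne p ?_
    rintro rfl
    exact h (Finset.mem_filter.mp hp).2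

/-- Extra indices contribute exponent $0$. A common set `s` is what lets the prefactors of different
lattice points be compared through the bimultiplicative pairing. -/
theorem latticeH_eq (π : YoungDiagram → ℂ) (n : ℤ →₀ ℤ) {s : Finset ℤ} (hs : n.support ⊆ s) :
    latticeH π n =
      (xPairing s n n : LocXT) * algebraMap XT LocXT (shiftEval n (tauKP π)) := by
  rw [latticeH, xPairing]
  congr 2
  refine Finset.prod_subset ?_ ?_
  · intro p hp
    rw [Finset.mem_filter, Finset.mem_product] at hp ⊢
    exact ⟨⟨hs hp.1.1, hs hp.1.2⟩, hp.2⟩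
  · intro p hp hp'
    rw [Finset.mem_filter, Finset.mem_product] at hp hp'
    have : n p.1 = 0 ∨ n p.2 = 0 := by
      by_contra h
      push Not at h
      exact hp' ⟨⟨Finsupp.mem_support_iff.mpr h.1, Finsupp.mem_support_iff.mpr h.2⟩, hp.2⟩
    rw [mul_eq_zero.mpr this, zpow_zero]

theorem coe_xDiff {i j : ℤ} (h : i ≠ j) :
    (xDiff i j : LocXT) = algebraMap XT LocXT (xVar i - xVar j) := by
  rw [xDiff, dif_pos h, IsUnit.unit_spec]

theorem vandProd_eq_det {k : ℕ} (z : Fin k → ℤ) :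
    vandProd z = (Matrix.vandermonde fun i => xVar (z i)).det := by
  rw [Matrix.det_vandermonde, vandProd]

theorem vandProd_comp_perm {k : ℕ} (z : Fin k → ℤ) (σ : Equiv.Perm (Fin k)) :
    vandProd (z ∘ σ) = ((Equiv.Perm.sign σ : ℤ) : XT) * vandProd z := by
  rw [vandProd_eq_det, vandProd_eq_det, ← Matrix.det_permute]
  rfl

theorem vandProd_eq_zero {k : ℕ} {z : Fin k → ℤ} (hz : ¬ Function.Injective z) :
    vandProd z = 0 := by
  obtain ⟨i, j, hij, hne⟩ := Function.not_injective_iff.mp hz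
  rw [vandProd_eq_det]
  refine Matrix.det_zero_of_row_eq hne ?_
  funext a
  simp [Matrix.vandermonde, hij]

/-- The sign `(-1) ^ (k (k - 1) / 2)`. -/
def revSign (k : ℕ) : ℤ := ∏ i : Fin k, ∏ _j ∈ Finset.Ioi i, (-1)

theorem prod_xDiff_of_strictMono {k : ℕ} {z : Fin k → ℤ} (hz : StrictMono z) :
    ((∏ a, ∏ b, (if z a < z b then xDiff (z a) (z b) else 1) : LocXTˣ) : LocXT) =
      (revSign k : LocXT) * algebraMap XT LocXT (vandProd z) := by
  classical
  have h1 : ∀ a, ∏ b, (if z a < z b then xDiff (z a) (z b) else 1) =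
      ∏ b ∈ Finset.Ioi a, xDiff (z a) (z b) := by
    intro a
    rw [← Finset.prod_filter]
    congr 1
    ext b
    simp [hz.lt_iff_lt]
  simp only [h1, Units.coe_prod, revSign, vandProd, map_prod, Int.cast_prod,
    ← Finset.prod_mul_distrib]
  refine Finset.prod_congr rfl fun a _ => Finset.prod_congr rfl fun b hb => ?_
  rw [coe_xDiff (hz (Finset.mem_Ioi.mp hb)).ne, map_sub, map_sub]
  push_cast
  ring

/-- The product over pairs is symmetric in the entries and the Vandermonde product is antisymmetric,
so sorting accounts for exactly $\mathrm{sgn}(z)$. For repeated entries both sides are zero. -/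
theorem sgn_mul_prod_xDiff {k : ℕ} (z : Fin k → ℤ) :
    (sgn z : LocXT) * ((∏ a, ∏ b, (if z a < z b then xDiff (z a) (z b) else 1) : LocXTˣ) : LocXT) =
      (revSign k : LocXT) * algebraMap XT LocXT (vandProd z) := by
  by_cases hz : Function.Injective z
  · have hmono : StrictMono (z ∘ Tuple.sort z) :=
      (Tuple.monotone_sort z).strictMono_of_injective (hz.comp (Tuple.sort z).injective)
    have h1 := prod_xDiff_of_strictMono hmono
    have h2 : (∏ a, ∏ b, (if (z ∘ Tuple.sort z) a < (z ∘ Tuple.sort z) b then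
        xDiff ((z ∘ Tuple.sort z) a) ((z ∘ Tuple.sort z) b) else 1) : LocXTˣ) =
        ∏ a, ∏ b, (if z a < z b then xDiff (z a) (z b) else 1) := by
      rw [← Equiv.prod_comp (Tuple.sort z) fun a =>
        ∏ b, (if z a < z b then xDiff (z a) (z b) else 1)]
      refine Finset.prod_congr rfl fun a _ => ?_
      exact Equiv.prod_comp (Tuple.sort z)
        fun b => if z (Tuple.sort z a) < z b then xDiff (z (Tuple.sort z a)) (z b) else 1
    rw [h2, vandProd_comp_perm, map_mul, map_intCast] at h1
    rw [sgn, if_pos hz, h1]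
    have hs : ((Equiv.Perm.sign (Tuple.sort z) : ℤ) : LocXT) *
        ((Equiv.Perm.sign (Tuple.sort z) : ℤ) : LocXT) = 1 := by
      rw [← Int.cast_mul, ← Units.val_mul, Int.units_mul_self, Units.val_one, Int.cast_one]
    linear_combination (revSign k : LocXT) * algebraMap XT LocXT (vandProd z) * hs
  · rw [sgn, if_neg hz, vandProd_eq_zero hz]
    simp

/-- The contribution of `α_i` to the prefactor in the background `N`. -/
def crossFactor (s : Finset ℤ) (N : ℤ →₀ ℤ) (i : ℤ) : LocXT :=
  ((xPairing s N (Finsupp.single i 1) * xPairing s (Finsupp.single i 1) N : LocXTˣ) : LocXT)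

/-- Skew-symmetrized lattice evaluations in terms of Vandermonde products. -/
theorem sgn_smul_latticeH (π : YoungDiagram → ℂ) (N : ℤ →₀ ℤ) {s : Finset ℤ} (hN : N.support ⊆ s)
    {k : ℕ} (z : Fin k → ℤ) (hz : ∀ a, z a ∈ s) :
    sgn z • latticeH π (N + ∑ a, Finsupp.single (z a) 1) =
      (revSign k : LocXT) * (xPairing s N N : LocXT) * (∏ a, crossFactor s N (z a)) *
        algebraMap XT LocXT
          (vandProd z * shiftEval (N + ∑ a, Finsupp.single (z a) 1) (tauKP π)) := by
  classical
  have hsupp : (N + ∑ a, Finsupp.single (z a) (1 : ℤ)).support ⊆ s := by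
    refine Finsupp.support_add.trans (Finset.union_subset hN ?_)
    refine Finsupp.support_finsetSum.trans ?_
    rw [Finset.biUnion_subset]
    intro a _ i hi
    have := Finsupp.support_single_subset hi
    rw [Finset.mem_singleton] at this
    rw [this]
    exact hz a
  have hpair : xPairing s (N + ∑ a, Finsupp.single (z a) 1) (N + ∑ a, Finsupp.single (z a) 1) =
      xPairing s N N * (∏ a, (xPairing s N (Finsupp.single (z a) 1) *
        xPairing s (Finsupp.single (z a) 1) N)) *
        ∏ a, ∏ b, (if z a < z b then xDiff (z a) (z b) else 1) := by
    rw [xPairing_add_left, xPairing_add_right, xPairing_add_right, xPairing_sum_right,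
      xPairing_sum_left, xPairing_sum_left]
    simp only [xPairing_sum_right, xPairing_single s (hz _) (hz _), Finset.prod_mul_distrib]
    simp only [mul_assoc]
  rw [latticeH_eq π _ hsupp, hpair, zsmul_eq_mul, map_mul]
  have h := sgn_mul_prod_xDiff z
  rw [Units.val_mul, Units.val_mul, Units.coe_prod]
  simp only [crossFactor]
  linear_combination (xPairing s N N : LocXT) * (∏ a, ((xPairing s N (Finsupp.single (z a) 1) *
        xPairing s (Finsupp.single (z a) 1) N : LocXTˣ) : LocXT)) *
        algebraMap XT LocXT (shiftEval (N + ∑ a, Finsupp.single (z a) 1) (tauKP π)) * h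

/-! ### Relations between lattice evaluations -/

/-- The image `sgn(L) H^{N + α_{L_1} + ⋯ + α_{L_k}}` of a Plücker coordinate. -/
def latticeCoord (π : YoungDiagram → ℂ) (N : ℤ →₀ ℤ) {k n : ℕ} (L : Fin k → Idx k n) : LocXT :=
  sgn (fun i => (L i : ℤ)) • latticeH π (N + ∑ i : Fin k, Finsupp.single (L i : ℤ) 1)

/-- A finite set containing the support of `N` and all the indices in `Idx k n`. -/
def indexSupport (N : ℤ →₀ ℤ) (k n : ℕ) : Finset ℤ :=
  N.support ∪ Finset.Icc (-(k : ℤ)) ((n : ℤ) - (k : ℤ) - 1)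

theorem latticeCoord_eq (π : YoungDiagram → ℂ) (N : ℤ →₀ ℤ) {k n : ℕ} (L : Fin k → Idx k n) :
    latticeCoord π N L = (revSign k : LocXT) * (xPairing (indexSupport N k n) N N : LocXT) *
      (∏ a, crossFactor (indexSupport N k n) N (L a)) * algebraMap XT LocXT
        (vandProd (fun i => (L i : ℤ)) *
          shiftEval (N + ∑ a, Finsupp.single (L a : ℤ) 1) (tauKP π)) :=
  sgn_smul_latticeH π N Finset.subset_union_left _ fun a =>
    Finset.mem_union_right _ (Finset.mem_Icc.mpr (L a).2)

theorem latticeCoord_skew (π : YoungDiagram → ℂ) (N : ℤ →₀ ℤ) {k n : ℕ} (L : Fin k → Idx k n)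
    (σ : Equiv.Perm (Fin k)) :
    latticeCoord π N L = ((Equiv.Perm.sign σ : ℤ) : LocXT) * latticeCoord π N (L ∘ σ) := by
  rw [latticeCoord_eq, latticeCoord_eq]
  simp only [Function.comp_apply]
  rw [Equiv.prod_comp σ (fun a => crossFactor (indexSupport N k n) N (L a)),
    Equiv.sum_comp σ (fun a => Finsupp.single (L a : ℤ) (1 : ℤ))]
  have h : vandProd (fun i => (L (σ i) : ℤ)) =
      ((Equiv.Perm.sign σ : ℤ) : XT) * vandProd fun i => (L i : ℤ) :=
    vandProd_comp_perm (fun i => (L i : ℤ)) σ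
  rw [h, map_mul, map_mul, map_mul, map_intCast]
  have hs : ((Equiv.Perm.sign σ : ℤ) : LocXT) * ((Equiv.Perm.sign σ : ℤ) : LocXT) = 1 := by
    rw [← Int.cast_mul, ← Units.val_mul, Int.units_mul_self, Units.val_one, Int.cast_one]
  linear_combination (-(revSign k : LocXT) * (xPairing (indexSupport N k n) N N : LocXT) *
    (∏ a, crossFactor (indexSupport N k n) N (L a)) *
      (algebraMap XT LocXT (vandProd fun i => (L i : ℤ)) * algebraMap XT LocXT
        (shiftEval (N + ∑ a, Finsupp.single (L a : ℤ) 1) (tauKP π)))) * hs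

/-- In every term the two tuples together use each entry of `I` and `J` once, so the cross factors
do not depend on $j$, and the relation is a multiple of `tauKP_fay`. -/
theorem latticeCoord_plucker {π : YoungDiagram → ℂ} (hπ : SatisfiesPlucker π) (N : ℤ →₀ ℤ)
    {m n : ℕ} (I : Fin m → Idx (m + 1) n) (J : Fin (m + 2) → Idx (m + 1) n) :
    ∑ j : Fin (m + 2), (-1) ^ ((j : ℕ) + 1) *
      (latticeCoord π N (Fin.snoc (α := fun _ => Idx (m + 1) n) I (J j)) *
        latticeCoord π N (fun a => J (j.succAbove a))) = 0 := by
  have h := congrArg (fun f => ((revSign (m + 1) : LocXT) *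
      (xPairing (indexSupport N (m + 1) n) N N : LocXT)) ^ 2 *
      (∏ a, crossFactor (indexSupport N (m + 1) n) N (I a)) *
      (∏ a, crossFactor (indexSupport N (m + 1) n) N (J a)) * algebraMap XT LocXT f)
    (tauKP_fay hπ N (fun i => (I i : ℤ)) fun i => (J i : ℤ))
  simp only [map_zero, mul_zero, map_sum, Finset.mul_sum] at h
  rw [← h]
  refine Finset.sum_congr rfl fun j _ => ?_
  have hsnoc : ∀ a, ((Fin.snoc (α := fun _ => Idx (m + 1) n) I (J j) a : Idx (m + 1) n) : ℤ) =
      Fin.snoc (α := fun _ => ℤ) (fun i => (I i : ℤ)) (J j : ℤ) a := by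
    intro a
    refine Fin.lastCases ?_ (fun b => ?_) a
    · rw [Fin.snoc_last, Fin.snoc_last]
    · rw [Fin.snoc_castSucc, Fin.snoc_castSucc]
  rw [latticeCoord_eq, latticeCoord_eq]
  simp only [hsnoc]
  rw [Fin.prod_univ_castSucc]
  simp only [Fin.snoc_castSucc, Fin.snoc_last]
  rw [Fin.prod_univ_succAbove (fun a => crossFactor (indexSupport N (m + 1) n) N (J a)) j]
  simp only [map_mul, map_pow, map_neg, map_one]
  ring

theorem aeval_latticeCoord_eq_zero {π : YoungDiagram → ℂ} (hπ : SatisfiesPlucker π) (N : ℤ →₀ ℤ)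
    {k n : ℕ} {p : PluckerPoly k n} (hp : p ∈ pluckerIdeal k n) :
    MvPolynomial.aeval (R := ℂ) (fun L : Fin k → Idx k n => latticeCoord π N L) p = 0 := by
  suffices h : pluckerIdeal k n ≤ RingHom.ker
      (MvPolynomial.aeval (R := ℂ) (fun L : Fin k → Idx k n => latticeCoord π N L)) from h hp
  refine Ideal.span_le.mpr ?_
  rintro p (⟨L, σ, rfl⟩ | hp)
  · rw [SetLike.mem_coe, RingHom.mem_ker, map_sub, map_mul, MvPolynomial.aeval_X,
      MvPolynomial.aeval_X, MvPolynomial.aeval_C, map_intCast, ← latticeCoord_skew, sub_self]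
  · cases k with
    | zero => exact hp.elim
    | succ m =>
      obtain ⟨I, J, rfl⟩ := hp
      rw [SetLike.mem_coe, RingHom.mem_ker, ← latticeCoord_plucker hπ N I J]
      simp only [map_sum, map_mul, map_pow, map_neg, map_one, MvPolynomial.aeval_X]

end KPLattice

end

theorem mainTheorem10 (π : YoungDiagram → ℂ) (hπ : π ≠ 0)
    (hw : Projectivization.mk ℂ π hπ ∈ KPLattice.InfGrassmannian)
    (k n : ℕ) (hk : 0 < k) (hkn : k < n) (N : ℤ →₀ ℤ) :
    ∃! φ : KPLattice.FinGrRing k n →ₐ[ℂ] KPLattice.LocXT,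
      ∀ L : Fin k → KPLattice.Idx k n,
        φ (KPLattice.pluckerCoord L) =
          KPLattice.sgn (fun i => (L i : ℤ)) •
            KPLattice.latticeH π (N + ∑ i : Fin k, Finsupp.single (L i : ℤ) 1) := by
  have hP := (KPLattice.mk_mem_infGrassmannian π hπ).mp hw
  refine ⟨Ideal.Quotient.liftₐ (KPLattice.pluckerIdeal k n)
    (MvPolynomial.aeval fun L => KPLattice.latticeCoord π N L)
    (fun p hp => KPLattice.aeval_latticeCoord_eq_zero hP N hp), ?_, ?_⟩
  · intro L
    exact MvPolynomial.aeval_X _ L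
  · intro ψ hψ
    -- The Plücker coordinates generate the algebra, which gives uniqueness.
    refine Ideal.Quotient.algHom_ext _ (MvPolynomial.algHom_ext fun L => ?_)
    exact (hψ L).trans (MvPolynomial.aeval_X (fun L => KPLattice.latticeCoord π N L) L).symm
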